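/- Let $k$ be a field and let $H$ be a Hopf algebra over $k$ (with $\Delta(h)=\sum h_1\otimes h_2$) that is semisimple as a ring. Let $A$ be a unital associative $k$-algebra which is a (left) partial $H$-module algebra, i.e. $A$ is equipped with a $k$-bilinear map $H\times A\to A$, $(h,a)\mapsto h\cdot a$, such that $1_H\cdot a=a$ and $h\cdot(a(g\cdot b))=\sum (h_1\cdot a)((h_2g)\cdot b)$ for all $a,b\in A$, $h,g\in H$. On $A\otimes_k H$, with $a\# h$ denoting $a\otimes h$, consider the associative (not necessarily unital) multiplication $(a\# h)(b\# g)=\sum a(h_1\cdot b)\# h_2g$, and let $\underline{A\# H}:=(A\# H)(1_A\# 1_H)$ be the partial smash product, a unital algebra with identity $1_A\# 1_H$. A right partial $(A,H)$-module is a right $A$-module $M$ with a $k$-bilinear map $(m,h)\mapsto m\triangleleft h$ such that $m\triangleleft 1_H=m$ and $((m\triangleleft h)a)\triangleleft g=\sum (m(h_1\cdot a))\triangleleft(h_2g)$; a left partial $(A,H)$-module is a left $A$-module $M$ with a $k$-bilinear map $(h,m)\mapsto h\triangleright m$ such that $1_H\triangleright m=m$ and $h\triangleright(a(g\triangleright m))=\sum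 (h_1\cdot a)((h_2g)\triangleright m)$. Such an $M$ is irreducible if $M\neq 0$ and its only $A$-submodules closed under the operation of $H$ are $0$ and $M$. A two-sided ideal $I$ of $A$ is $H$-stable if $H\cdot I\subseteq I$; then $A/I$ is a partial $H$-module algebra via $h\cdot(a+I)=h\cdot a+I$. An $H$-stable ideal $I$ is right (resp. left) $H$-primitive if there is an irreducible right (resp. left) partial $(A/I,H)$-module that is faithful as an $A/I$-module. The algebra $A$ is $H$-semiprimitive if its $H$-Jacobson radical is zero, i.e. if the intersection of all right $H$-primitive ideals of $A$, or the intersection of all left $H$-primitive ideals of $A$, is zero (either of the two conditions suffices here). **Theorem.** If $A$ is $H$-semiprimitive, and if every irreducible right $A$-module is finite-dimensional over $k$ or every irreducible left $A$-module is finite-dimensional over $k$, then $\underline{A\# H}$ is semiprimitive, i.e. its Jacobson radical is zero. -/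

import Mathlib

open scoped TensorProduct

universe w v u

/-- A (left) partial action of the Hopf algebra `H` on the unital `k`-algebra `A`: a `k`-bilinear
map `(h, a) ↦ h · a` with `1 · a = a` and `h · (a (g · b)) = ∑ (h₁ · a) ((h₂ g) · b)`. The sum is
written as the value at `Δ(h)` of the linear map `x ⊗ y ↦ (x · a) ((y g) · b)`. With this structure
`A` is a (left) partial `H`-module algebra. -/
structure PartialHopfAction (k H A : Type*) [Field k] [Ring H] [HopfAlgebra k H]
    [Ring A] [Algebra k A] where
  act : H →ₗ[k] A →ₗ[k] A
  one_act : ∀ a : A, act 1 a = a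
  act_mul_act : ∀ (h g : H) (a b : A),
    act h (a * act g b) =
      TensorProduct.lift
        ((LinearMap.mul k A).compl₁₂ (act.flip a) (act.flip b ∘ₗ LinearMap.mulRight k g))
        (Coalgebra.comul (R := k) h)

namespace PartialHopfAction

section Smash

variable {k H A : Type*} [Field k] [Ring H] [HopfAlgebra k H] [Ring A] [Algebra k A]
  (P : PartialHopfAction k H A)

/-- The underlying vector space `A ⊗ H` of the (non-unital) algebra `A # H`. -/
@[nolint unusedArguments]
def Smash (_P : PartialHopfAction k H A) : Type _ := A ⊗[k] H

noncomputable instance : AddCommGroup P.Smash := inferInstanceAs (AddCommGroup (A ⊗[k] H))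

noncomputable instance : Module k P.Smash := inferInstanceAs (Module k (A ⊗[k] H))

/-- The element `a # h` of `A # H`. -/
noncomputable def smashTmul (a : A) (h : H) : P.Smash := (a ⊗ₜ[k] h : A ⊗[k] H)

/-- The bilinear map `(h, b) ↦ ∑ (h₁ · b) # h₂`. -/
noncomputable def twist : H →ₗ[k] A →ₗ[k] A ⊗[k] H :=
  LinearMap.mk₂ k (fun h b => (P.act.flip b).rTensor H (Coalgebra.comul (R := k) h))
    (by intros; simp) (by intros; simp)
    (by intros; simp [LinearMap.rTensor_add]) (by intros; simp [LinearMap.rTensor_smul])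

/-- The bilinear map `((a # h), (b # g)) ↦ ∑ a (h₁ · b) # h₂ g`. -/
noncomputable def smashMul : A ⊗[k] H →ₗ[k] A ⊗[k] H →ₗ[k] A ⊗[k] H :=
  TensorProduct.lift (LinearMap.mk₂ k
    (fun a h => TensorProduct.lift (LinearMap.mk₂ k
      (fun b g => TensorProduct.map (LinearMap.mulLeft k a) (LinearMap.mulRight k g)
        (P.twist h b))
      (by intros; simp) (by intros; simp)
      (by
        intro b g g'
        rw [← LinearMap.add_apply, ← TensorProduct.map_add_right]
        congr 2; ext; simp [mul_add])
      (by
        intro c b g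
        rw [← LinearMap.smul_apply, ← TensorProduct.map_smul_right]
        congr 2; ext; simp)))
    (by
      intro a a' h; ext b g
      simp only [TensorProduct.AlgebraTensorModule.curry_apply, TensorProduct.curry_apply,
        LinearMap.coe_restrictScalars, TensorProduct.lift.tmul, LinearMap.mk₂_apply,
        LinearMap.add_apply]
      rw [← LinearMap.add_apply, ← TensorProduct.map_add_left]
      congr 2; ext; simp [add_mul])
    (by
      intro c a h; ext b g
      simp only [TensorProduct.AlgebraTensorModule.curry_apply, TensorProduct.curry_apply,
        LinearMap.coe_restrictScalars, TensorProduct.lift.tmul, LinearMap.mk₂_apply,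
        LinearMap.smul_apply]
      rw [← LinearMap.smul_apply, ← TensorProduct.map_smul_left]
      congr 2; ext; simp)
    (by intros; ext; simp)
    (by intros; ext; simp))

theorem smashMul_tmul (a b : A) (h g : H) :
    P.smashMul (a ⊗ₜ h) (b ⊗ₜ g) =
      TensorProduct.map (LinearMap.mulLeft k a ∘ₗ P.act.flip b) (LinearMap.mulRight k g)
        (Coalgebra.comul (R := k) h) := by
  simp only [smashMul, twist, TensorProduct.lift.tmul, LinearMap.mk₂_apply, LinearMap.rTensor]
  rw [← LinearMap.comp_apply, ← TensorProduct.map_comp]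
  simp

/-- The multiplication rule `(a # h) (b # g) = ∑ a (h₁ · b) # h₂ g`. -/
theorem smashMul_tmul_repr (a b : A) (h g : H) {ι : Type*} (r : Coalgebra.Repr k h ι) :
    P.smashMul (a ⊗ₜ h) (b ⊗ₜ g) =
      ∑ i ∈ r.index, (a * P.act (r.left i) b) ⊗ₜ[k] (r.right i * g) := by
  rw [smashMul_tmul, ← r.eq]
  simp

theorem act_mul_act_repr (h g : H) (a b : A) {ι : Type*} (r : Coalgebra.Repr k h ι) :
    P.act h (a * P.act g b) =
      ∑ i ∈ r.index, P.act (r.left i) a * P.act (r.right i * g) b := by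
  rw [P.act_mul_act, ← r.eq]
  simp

theorem smashMul_assoc (x y z : A ⊗[k] H) :
    P.smashMul (P.smashMul x y) z = P.smashMul x (P.smashMul y z) := by
  induction x using TensorProduct.induction_on with
  | zero => simp
  | add x x' hx hx' => simp only [map_add, LinearMap.add_apply, hx, hx']
  | tmul a h =>
  induction y using TensorProduct.induction_on with
  | zero => simp
  | add y y' hy hy' => simp only [map_add, LinearMap.add_apply, hy, hy']
  | tmul b g =>
  induction z using TensorProduct.induction_on with
  | zero => simp
  | add z z' hz hz' => simp only [map_add, hz, hz']
  | tmul c l =>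
  classical
  let r := Coalgebra.Repr.arbitrary k h
  let s := Coalgebra.Repr.arbitrary k g
  let r₁ := fun i => Coalgebra.Repr.arbitrary k (r.left i)
  let r₂ := fun i => Coalgebra.Repr.arbitrary k (r.right i)
  let F : H × H → (H ⊗[k] (H ⊗[k] H) →ₗ[k] A ⊗[k] H) := fun j =>
    TensorProduct.map
      (LinearMap.mulLeft k a ∘ₗ LinearMap.mul' k A ∘ₗ TensorProduct.map (P.act.flip b)
        (P.act.flip c ∘ₗ LinearMap.mulRight k (s.left j)))
      (LinearMap.mulRight k (s.right j * l)) ∘ₗ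
    (TensorProduct.assoc k H H H).symm.toLinearMap
  have hF : ∀ j p q t, F j (p ⊗ₜ (q ⊗ₜ t)) =
      (a * (P.act p b * P.act (q * s.left j) c)) ⊗ₜ (t * (s.right j * l)) := by
    intro j p q t; simp [F, mul_assoc]
  have key := fun j => congrArg (F j) (Coalgebra.sum_tmul_tmul_eq r r₁ r₂)
  simp only [map_sum, hF] at key
  have e₁ : P.smashMul (P.smashMul (a ⊗ₜ h) (b ⊗ₜ g)) (c ⊗ₜ l) =
      ∑ j ∈ s.index, ∑ i ∈ r.index, ∑ m ∈ (r₂ i).index,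
        (a * (P.act (r.left i) b * P.act ((r₂ i).left m * s.left j) c)) ⊗ₜ
          ((r₂ i).right m * (s.right j * l)) := by
    rw [P.smashMul_tmul_repr a b h g r, map_sum, LinearMap.sum_apply, Finset.sum_comm]
    refine Finset.sum_congr rfl fun i _ => ?_
    rw [smashMul_tmul, Bialgebra.comul_mul, ← (r₂ i).eq, ← s.eq, Finset.sum_mul_sum,
      Finset.sum_comm]
    simp [mul_assoc]
  have e₂ : P.smashMul (a ⊗ₜ h) (P.smashMul (b ⊗ₜ g) (c ⊗ₜ l)) =
      ∑ j ∈ s.index, ∑ i ∈ r.index, ∑ m ∈ (r₁ i).index,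
        (a * (P.act ((r₁ i).left m) b * P.act ((r₁ i).right m * s.left j) c)) ⊗ₜ
          (r.right i * (s.right j * l)) := by
    rw [P.smashMul_tmul_repr b c g l s, map_sum]
    refine Finset.sum_congr rfl fun j _ => ?_
    rw [P.smashMul_tmul_repr _ _ h _ r]
    refine Finset.sum_congr rfl fun i _ => ?_
    rw [P.act_mul_act_repr _ _ _ _ (r₁ i), Finset.mul_sum, TensorProduct.sum_tmul]
  rw [e₁, e₂]
  exact Finset.sum_congr rfl fun j _ => (key j).symm

/-- `A # H` as an associative, in general non-unital, algebra. -/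
noncomputable instance : NonUnitalRing P.Smash :=
  { (inferInstance : AddCommGroup P.Smash) with
    mul := fun x y => P.smashMul x y
    left_distrib := fun x y z => (P.smashMul x).map_add y z
    right_distrib := fun x y z => P.smashMul.map_add₂ x y z
    zero_mul := fun x => P.smashMul.map_zero₂ x
    mul_zero := fun x => (P.smashMul x).map_zero
    mul_assoc := P.smashMul_assoc }

theorem smash_mul_def (x y : P.Smash) : x * y = (P.smashMul x y : A ⊗[k] H) := rfl

instance : IsScalarTower k P.Smash P.Smash := ⟨fun c x y => P.smashMul.map_smul₂ c x y⟩

instance : SMulCommClass k P.Smash P.Smash := ⟨fun c x y => ((P.smashMul x).map_smul c y).symm⟩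

/-- The element `1_A # 1_H`, a left identity of `A # H`. -/
noncomputable def smashOne : P.Smash := P.smashTmul 1 1

theorem smashOne_mul (x : P.Smash) : P.smashOne * x = x := by
  change P.smashMul ((1 : A) ⊗ₜ (1 : H)) x = x
  induction x using TensorProduct.induction_on with
  | zero => exact (P.smashMul _).map_zero
  | add x y hx hy => exact ((P.smashMul _).map_add x y).trans (congrArg₂ _ hx hy)
  | tmul b g =>
    rw [smashMul_tmul, Bialgebra.comul_one, Algebra.TensorProduct.one_def]
    simp [P.one_act]

/-- The subspace `(A # H) (1_A # 1_H)` of `A # H`, closed under multiplication. -/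
noncomputable def partialSmashSubalgebra : NonUnitalSubalgebra k P.Smash where
  carrier := {x | ∃ y, x = y * P.smashOne}
  add_mem' := by
    rintro _ _ ⟨x, rfl⟩ ⟨y, rfl⟩
    exact ⟨x + y, (add_mul _ _ _).symm⟩
  zero_mem' := ⟨0, (zero_mul _).symm⟩
  mul_mem' := by
    rintro _ _ ⟨x, rfl⟩ ⟨y, rfl⟩
    exact ⟨x * P.smashOne * y, by simp only [mul_assoc]⟩
  smul_mem' := by
    rintro c _ ⟨x, rfl⟩
    exact ⟨c • x, (smul_mul_assoc _ _ _).symm⟩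

/-- The partial smash product of `A` by `H`: the algebra `(A # H) (1_A # 1_H)`, whose identity
element is `1_A # 1_H`. -/
def PartialSmash : Type _ := P.partialSmashSubalgebra

noncomputable instance : NonUnitalRing P.PartialSmash :=
  inferInstanceAs (NonUnitalRing P.partialSmashSubalgebra)

noncomputable instance : Ring P.PartialSmash :=
  { (inferInstance : NonUnitalRing P.PartialSmash) with
    one := ⟨P.smashOne, P.smashOne, (P.smashOne_mul _).symm⟩
    one_mul := fun x => Subtype.ext (P.smashOne_mul x.1)
    mul_one := fun x => Subtype.ext <| by
      obtain ⟨_, y, rfl⟩ := x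
      exact (mul_assoc _ _ _).trans (congrArg (y * ·) (P.smashOne_mul _)) }

noncomputable instance : Module k P.PartialSmash :=
  inferInstanceAs (Module k P.partialSmashSubalgebra)

noncomputable instance : Algebra k P.PartialSmash :=
  Algebra.ofModule (fun c x y => Subtype.ext (smul_mul_assoc c x.1 y.1))
    (fun c x y => Subtype.ext (mul_smul_comm c x.1 y.1))

end Smash

section Stable

variable {k H A : Type*} [Field k] [Ring H] [HopfAlgebra k H] [Ring A] [Algebra k A]
  (P : PartialHopfAction k H A)

/-- A two-sided ideal `I` of `A` is `H`-stable if `H · I ⊆ I`. -/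
def IsStable (I : Ideal A) : Prop := ∀ (h : H), ∀ a ∈ I, P.act h a ∈ I

variable {P}

/-- The partial action `h · (a + I) = h · a + I` of `H` on `A / I`, for an `H`-stable two-sided
ideal `I`. -/
def quotient {I : Ideal A} [I.IsTwoSided] (hI : P.IsStable I) :
    PartialHopfAction k H (A ⧸ I) where
  act := LinearMap.mk₂' k k
    (fun h => Submodule.mapQ (I.restrictScalars k) (I.restrictScalars k) (P.act h) (hI h))
    (by
      intro h h' x
      obtain ⟨a, rfl⟩ := Ideal.Quotient.mk_surjective x
      exact congrArg (Ideal.Quotient.mk I) (by simp))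
    (by
      intro c h x
      obtain ⟨a, rfl⟩ := Ideal.Quotient.mk_surjective x
      exact congrArg (Ideal.Quotient.mkₐ k I) (by simp))
    (fun h x y => map_add _ x y)
    (fun c h x => map_smul _ c x)
  one_act := by
    intro x
    obtain ⟨a, rfl⟩ := Ideal.Quotient.mk_surjective x
    exact congrArg (Ideal.Quotient.mk I) (P.one_act a)
  act_mul_act := by
    intro h g x y
    obtain ⟨a, rfl⟩ := Ideal.Quotient.mk_surjective x
    obtain ⟨b, rfl⟩ := Ideal.Quotient.mk_surjective y
    refine (congrArg (Ideal.Quotient.mkₐ k I) (P.act_mul_act h g a b)).trans ?_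
    rw [← (Coalgebra.Repr.arbitrary k h).eq]
    simp only [map_sum]
    exact Finset.sum_congr rfl fun i _ => rfl

theorem quotient_act_mk {I : Ideal A} [I.IsTwoSided] (hI : P.IsStable I) (h : H) (a : A) :
    (quotient hI).act h (Ideal.Quotient.mk I a) = Ideal.Quotient.mk I (P.act h a) := rfl

end Stable

section Modules

variable {k H A : Type*} [Field k] [Ring H] [HopfAlgebra k H] [Ring A] [Algebra k A]

/-- A right partial `(A, H)`-module structure on a right `A`-module `M`: a `k`-bilinear map
`(m, h) ↦ m ◁ h` with `m ◁ 1 = m` and `((m ◁ h) a) ◁ g = ∑ (m (h₁ · a)) ◁ (h₂ g)`. -/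
structure RightPartialModule (P : PartialHopfAction k H A) (M : Type*) [AddCommGroup M]
    [Module k M] [Module Aᵐᵒᵖ M] [IsScalarTower k Aᵐᵒᵖ M] where
  act : M →ₗ[k] H →ₗ[k] M
  act_one : ∀ m : M, act m 1 = m
  act_smul_act : ∀ (m : M) (a : A) (h g : H),
    act (MulOpposite.op a • act m h) g =
      TensorProduct.lift
        (act.compl₁₂
          ((LinearMap.toSpanSingleton Aᵐᵒᵖ M m).restrictScalars k ∘ₗ
            (MulOpposite.opLinearEquiv k).toLinearMap ∘ₗ P.act.flip a)
          (LinearMap.mulRight k g))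
        (Coalgebra.comul (R := k) h)

/-- A left partial `(A, H)`-module structure on a left `A`-module `M`: a `k`-bilinear map
`(h, m) ↦ h ▷ m` with `1 ▷ m = m` and `h ▷ (a (g ▷ m)) = ∑ (h₁ · a) ((h₂ g) ▷ m)`. -/
structure LeftPartialModule (P : PartialHopfAction k H A) (M : Type*) [AddCommGroup M]
    [Module k M] [Module A M] [IsScalarTower k A M] where
  act : H →ₗ[k] M →ₗ[k] M
  one_act : ∀ m : M, act 1 m = m
  act_smul_act : ∀ (m : M) (a : A) (h g : H),
    act h (a • act g m) =
      TensorProduct.lift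
        ((Algebra.lsmul k k M).toLinearMap.compl₁₂ (P.act.flip a)
          (act.flip m ∘ₗ LinearMap.mulRight k g))
        (Coalgebra.comul (R := k) h)

variable {P : PartialHopfAction k H A} {M : Type*} [AddCommGroup M] [Module k M]

theorem RightPartialModule.act_smul_act_repr [Module Aᵐᵒᵖ M] [IsScalarTower k Aᵐᵒᵖ M]
    (Q : P.RightPartialModule M) (m : M) (a : A) (h g : H) {ι : Type*}
    (r : Coalgebra.Repr k h ι) :
    Q.act (MulOpposite.op a • Q.act m h) g =
      ∑ i ∈ r.index, Q.act (MulOpposite.op (P.act (r.left i) a) • m) (r.right i * g) := by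
  rw [Q.act_smul_act, ← r.eq]
  simp

theorem LeftPartialModule.act_smul_act_repr [Module A M] [IsScalarTower k A M]
    (Q : P.LeftPartialModule M) (m : M) (a : A) (h g : H) {ι : Type*}
    (r : Coalgebra.Repr k h ι) :
    Q.act h (a • Q.act g m) =
      ∑ i ∈ r.index, P.act (r.left i) a • Q.act (r.right i * g) m := by
  rw [Q.act_smul_act, ← r.eq]
  simp

/-- `M ≠ 0`, and the only partial submodules of `M` are `0` and `M`. -/
def RightPartialModule.IsIrreducible [Module Aᵐᵒᵖ M] [IsScalarTower k Aᵐᵒᵖ M]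
    (Q : P.RightPartialModule M) : Prop :=
  Nontrivial M ∧ ∀ N : Submodule Aᵐᵒᵖ M, (∀ m ∈ N, ∀ h : H, Q.act m h ∈ N) → N = ⊥ ∨ N = ⊤

/-- `M ≠ 0`, and the only partial submodules of `M` are `0` and `M`. -/
def LeftPartialModule.IsIrreducible [Module A M] [IsScalarTower k A M]
    (Q : P.LeftPartialModule M) : Prop :=
  Nontrivial M ∧ ∀ N : Submodule A M, (∀ m ∈ N, ∀ h : H, Q.act h m ∈ N) → N = ⊥ ∨ N = ⊤

end Modules

section Radical

variable {k : Type w} {H : Type v} {A : Type u} [Field k] [Ring H] [HopfAlgebra k H] [Ring A]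
  [Algebra k A] (P : PartialHopfAction k H A)

/-- `A` is right `H`-primitive: it has a faithful irreducible right partial `(A, H)`-module. An
irreducible one is a cyclic module over the partial smash product, so the universe of `A ⊗ H` is
large enough. -/
def IsRightPrimitive : Prop :=
  ∃ (M : Type (max u v)) (_ : AddCommGroup M) (_ : Module k M) (_ : Module Aᵐᵒᵖ M)
    (_ : IsScalarTower k Aᵐᵒᵖ M) (Q : P.RightPartialModule M),
    Q.IsIrreducible ∧ ∀ a : A, (∀ m : M, MulOpposite.op a • m = 0) → a = 0

/-- `A` is left `H`-primitive: it has a faithful irreducible left partial `(A, H)`-module. -/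
def IsLeftPrimitive : Prop :=
  ∃ (M : Type (max u v)) (_ : AddCommGroup M) (_ : Module k M) (_ : Module A M)
    (_ : IsScalarTower k A M) (Q : P.LeftPartialModule M),
    Q.IsIrreducible ∧ ∀ a : A, (∀ m : M, a • m = 0) → a = 0

/-- An `H`-stable two-sided ideal `I` of `A` is right `H`-primitive if `A / I` is. -/
def IsRightPrimitiveIdeal (I : Ideal A) : Prop :=
  ∃ (_ : I.IsTwoSided) (hI : P.IsStable I), (quotient hI).IsRightPrimitive

/-- An `H`-stable two-sided ideal `I` of `A` is left `H`-primitive if `A / I` is. -/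
def IsLeftPrimitiveIdeal (I : Ideal A) : Prop :=
  ∃ (_ : I.IsTwoSided) (hI : P.IsStable I), (quotient hI).IsLeftPrimitive

/-- The intersection of all right `H`-primitive ideals of `A`. -/
def rightJacobson : Ideal A := sInf {I | P.IsRightPrimitiveIdeal I}

/-- The intersection of all left `H`-primitive ideals of `A`. -/
def leftJacobson : Ideal A := sInf {I | P.IsLeftPrimitiveIdeal I}

/-- `A` is `H`-semiprimitive: its `H`-Jacobson radical, the intersection of all right (or left)
`H`-primitive ideals, is zero. Both descriptions of the radical are admitted. -/
def IsSemiprimitive : Prop := P.rightJacobson = ⊥ ∨ P.leftJacobson = ⊥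

end Radical

end PartialHopfAction

/-! Semisimplicity of H yields a two-sided integral L with ε(L) = 1; hence H is finite-dimensional
and its antipode S is bijective.

Let x lie in the radical of the partial smash product and let V be a finite-dimensional simple left
A-module. Then A # H acts on the functions H → V by a # h ↦ φ(a)τ(h), where τ is translation and
(φ(a)f)(t) = ∑ (t₁·a) f(t₂). Although the action on A is only partial, the adjoint action ▷ of H on
operators satisfies φ(c)(h ▷ φ(a)) = φ(c(h·a)) (`mulOp_mul_adj`). So φ(A) lies in an H-stable
operator algebra B with φ(A)B ⊆ φ(A), and A # H maps onto a right ideal of the algebra R generated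
by B and τ(H). The functions form a semisimple R-module (`isSemisimpleModule_opAlgebra`), which
forces x to act as zero. Using S⁻¹, the coefficients of x in A can be read off from this action:
they and all their H-translates annihilate V.

Semisimplicity over R is a Maschke argument: averaging with L turns B-splittings into R-splittings,
so it suffices that nonzero R-quotients are B-projective. This comes from counting dimensions
(`projective_of_coreFree`). For an R-module M, pick a simple B-module W maximizing dim Hom(M, W) /
dim W. Coinduction from W multiplies the denominator by dim H and the numerator by at least dim H,
so the coinduced module attains the maximal ratio. If it is faithful, every finite-dimensional
B-module attains it; then Hom(M, -) preserves the relevant surjections and M is projective.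

Since simple A-modules on one side are finite-dimensional, the coefficients of x and their
translates lie in the Jacobson radical of A. By Nakayama, such a coefficient a has a # 1 in the
radical of the partial smash product (`incl_mem_jacobson`), hence annihilates all irreducible
partial modules and lies in every H-primitive ideal. By H-semiprimitivity a = 0, so x = 0. -/

section

open Coalgebra HopfAlgebra

/-! ### Sweedler calculus with unbundled multilinear functions -/

section Sweedler

variable {k H M : Type*} [Field k] [Ring H] [HopfAlgebra k H] [AddCommGroup M]

/-- Bilinearity of an unbundled function of two variables. -/
structure IsBilin (k : Type*) {H M : Type*} [Field k] [AddCommGroup H] [Module k H]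
    [AddCommGroup M] [Module k M] (F : H → H → M) : Prop where
  add_left : ∀ x x' y, F (x + x') y = F x y + F x' y
  smul_left : ∀ (c : k) x y, F (c • x) y = c • F x y
  add_right : ∀ x y y', F x (y + y') = F x y + F x y'
  smul_right : ∀ (c : k) x y, F x (c • y) = c • F x y

/-- Trilinearity of an unbundled function of three variables. -/
structure IsTrilin (k : Type*) {H M : Type*} [Field k] [AddCommGroup H] [Module k H]
    [AddCommGroup M] [Module k M] (T : H → H → H → M) : Prop where
  add₁ : ∀ x x' y z, T (x + x') y z = T x y z + T x' y z
  smul₁ : ∀ (c : k) x y z, T (c • x) y z = c • T x y z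
  add₂ : ∀ x y y' z, T x (y + y') z = T x y z + T x y' z
  smul₂ : ∀ (c : k) x y z, T x (c • y) z = c • T x y z
  add₃ : ∀ x y z z', T x y (z + z') = T x y z + T x y z'
  smul₃ : ∀ (c : k) x y z, T x y (c • z) = c • T x y z

/-- The Sweedler sum `∑ F h₁ h₂`. -/
noncomputable def sw (k : Type*) {H M : Type*} [Field k] [Ring H] [HopfAlgebra k H]
    [AddCommGroup M] (F : H → H → M) (h : H) : M :=
  ∑ i ∈ (ℛ k h).index, F ((ℛ k h).left i) ((ℛ k h).right i)

theorem map_sw {N G : Type*} [AddCommGroup N] [FunLike G M N] [AddMonoidHomClass G M N] (g : G)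
    (F : H → H → M) (h : H) : g (sw k F h) = sw k (fun x y => g (F x y)) h := by
  simp [sw]

theorem mul_sw {R : Type*} [Ring R] (a : R) (F : H → H → R) (h : H) :
    a * sw k F h = sw k (fun x y => a * F x y) h := by
  simp [sw, Finset.mul_sum]

theorem sw_mul {R : Type*} [Ring R] (a : R) (F : H → H → R) (h : H) :
    sw k F h * a = sw k (fun x y => F x y * a) h := by
  simp [sw, Finset.sum_mul]

theorem smul_sw {R : Type*} [Ring R] [Module R M] (a : R) (F : H → H → M) (h : H) :
    a • sw k F h = sw k (fun x y => a • F x y) h := by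
  simp [sw, Finset.smul_sum]

theorem sw_smul_vec {R : Type*} [Ring R] [Module R M] (m : M) (F : H → H → R) (h : H) :
    sw k F h • m = sw k (fun x y => F x y • m) h := by
  simp [sw, Finset.sum_smul]

theorem sw_apply {N Q : Type*} [AddCommGroup N] [Module k N] [AddCommGroup Q] [Module k Q]
    (F : H → H → (N →ₗ[k] Q)) (h : H) (n : N) :
    sw k F h n = sw k (fun x y => F x y n) h := by
  simp [sw]

theorem sw_congr {F G : H → H → M} (h : H) (e : ∀ x y, F x y = G x y) : sw k F h = sw k G h := by
  simp [sw, e]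

theorem sw_mem {S : Type*} [SetLike S M] [AddSubmonoidClass S M] (N : S) {F : H → H → M} (h : H)
    (e : ∀ x y, F x y ∈ N) : sw k F h ∈ N :=
  sum_mem fun _ _ => e _ _

theorem sw_zero (h : H) : sw k (fun _ _ => (0 : M)) h = 0 := by
  simp [sw]

theorem sw_comm (F : H → H → H → H → M) (h g : H) :
    sw k (fun x y => sw k (fun p q => F x y p q) g) h =
      sw k (fun p q => sw k (fun x y => F x y p q) h) g :=
  Finset.sum_comm

variable [Module k M]

/-- The bilinear map underlying an unbundled bilinear function. -/
def IsBilin.toLin {F : H → H → M} (hF : IsBilin k F) : H →ₗ[k] H →ₗ[k] M :=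
  LinearMap.mk₂ k F hF.add_left hF.smul_left hF.add_right hF.smul_right

theorem sw_eq_lift {F : H → H → M} (hF : IsBilin k F) (h : H) :
    sw k F h = TensorProduct.lift hF.toLin (comul (R := k) h) := by
  rw [← (ℛ k h).eq]
  simp [sw, IsBilin.toLin]

theorem sw_add {F : H → H → M} (hF : IsBilin k F) (h h' : H) :
    sw k F (h + h') = sw k F h + sw k F h' := by
  simp [sw_eq_lift hF]

theorem sw_smul {F : H → H → M} (hF : IsBilin k F) (c : k) (h : H) :
    sw k F (c • h) = c • sw k F h := by
  simp [sw_eq_lift hF]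

/-- Coassociativity. Many later identities choose a T whose two bracketings collapse differently,
one through an antipode or counit axiom. -/
theorem sw_assoc {T : H → H → H → M} (hT : IsTrilin k T) (h : H) :
    sw k (fun x y => sw k (fun p q => T p q y) x) h =
      sw k (fun x y => sw k (fun p q => T x p q) y) h := by
  let T' : H →ₗ[k] H →ₗ[k] H →ₗ[k] M :=
    LinearMap.mk₂ k (fun x y => (⟨⟨fun z => T x y z, hT.add₃ x y⟩, fun c => hT.smul₃ c x y⟩))
      (fun _ _ _ => LinearMap.ext fun _ => hT.add₁ _ _ _ _)
      (fun _ _ _ => LinearMap.ext fun _ => hT.smul₁ _ _ _ _)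
      (fun _ _ _ => LinearMap.ext fun _ => hT.add₂ _ _ _ _)
      (fun _ _ _ => LinearMap.ext fun _ => hT.smul₂ _ _ _ _)
  have key := congrArg (TensorProduct.lift
      ((TensorProduct.lift.equiv (.id k) H H M).toLinearMap ∘ₗ T' : H →ₗ[k] H ⊗[k] H →ₗ[k] M)) <|
    sum_tmul_tmul_eq (ℛ k h) (fun i => ℛ k ((ℛ k h).left i)) (fun i => ℛ k ((ℛ k h).right i))
  simpa [T', sw] using key

theorem sw_one {F : H → H → M} (hF : IsBilin k F) : sw k F 1 = F 1 1 := by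
  simp [sw_eq_lift hF, Algebra.TensorProduct.one_def, IsBilin.toLin]

theorem sw_comul_mul {F : H → H → M} (hF : IsBilin k F) (h g : H) :
    sw k F (h * g) = sw k (fun x y => sw k (fun p q => F (x * p) (y * q)) g) h := by
  rw [sw_eq_lift hF, Bialgebra.comul_mul, ← (ℛ k h).eq, ← (ℛ k g).eq, Finset.sum_mul_sum]
  simp [sw, IsBilin.toLin]

theorem sw_counit_left {f : H → M} (hf : IsLinearMap k f) (h : H) :
    sw k (fun x y => counit (R := k) x • f y) h = f h := by
  conv_rhs => rw [← sum_counit_smul (ℛ k h), ← hf.mk'_apply, map_sum]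
  simp [sw]

theorem sum_smul_counit (h : H) : sw k (fun x y => counit (R := k) y • x) h = h := by
  have key := congrArg (TensorProduct.lift (LinearMap.lsmul k H).flip)
    (sum_tmul_counit_eq (R := k) (ℛ k h))
  rw [map_sum] at key
  simpa only [sw, TensorProduct.lift.tmul, LinearMap.flip_apply, LinearMap.lsmul_apply,
    one_smul] using key

theorem sw_counit_right {f : H → M} (hf : IsLinearMap k f) (h : H) :
    sw k (fun x y => counit (R := k) y • f x) h = f h := by
  conv_rhs => rw [← sum_smul_counit (k := k) h, ← hf.mk'_apply, map_sw]
  simp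

theorem sw_antipode_left {f : H → M} (hf : IsLinearMap k f) (h : H) :
    sw k (fun x y => f (antipode k x * y)) h = counit (R := k) h • f 1 := by
  simp_rw [← hf.mk'_apply]
  rw [← map_sw (hf.mk' f), sw, sum_antipode_mul_eq_smul, map_smul]

theorem sw_antipode_right {f : H → M} (hf : IsLinearMap k f) (h : H) :
    sw k (fun x y => f (x * antipode k y)) h = counit (R := k) h • f 1 := by
  simp_rw [← hf.mk'_apply]
  rw [← map_sw (hf.mk' f), sw, sum_mul_antipode_eq_smul, map_smul]

end Sweedler

/-! ### Integrals, finiteness and the antipode of a semisimple Hopf algebra -/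

section Integral

/-- Split 1 = e + f along a complement J of I: for x in I, xf = x - xe lies in I ∩ J = 0. -/
theorem IsSemisimpleRing.exists_right_identity {R : Type*} [Ring R] [IsSemisimpleRing R]
    (I : Ideal R) : ∃ e ∈ I, ∀ x ∈ I, x * e = x := by
  obtain ⟨J, hJ⟩ := exists_isCompl I
  obtain ⟨e, he, f, hf, hef⟩ := Submodule.mem_sup.1
    (hJ.sup_eq_top ▸ Submodule.mem_top : (1 : R) ∈ I ⊔ J)
  refine ⟨e, he, fun x hx => ?_⟩
  have h1 : x * f = x - x * e := by rw [eq_sub_iff_add_eq, ← mul_add, add_comm f, hef, mul_one]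
  have h2 : x * f ∈ I ⊓ J :=
    ⟨h1 ▸ I.sub_mem hx (I.mul_mem_left x he), J.mul_mem_left x hf⟩
  rw [hJ.inf_eq_bot, Submodule.mem_bot, h1, sub_eq_zero] at h2
  exact h2.symm

/-- Take l = 1 - e with e a right identity of ker χ; then h - χ(h) is killed by l. -/
theorem IsSemisimpleRing.exists_mul_eq_smul {k R : Type*} [Field k] [Ring R] [Algebra k R]
    [IsSemisimpleRing R] (χ : R →ₐ[k] k) : ∃ l : R, χ l = 1 ∧ ∀ h, h * l = χ h • l := by
  obtain ⟨e, he, hxe⟩ := exists_right_identity (RingHom.ker χ)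
  refine ⟨1 - e, by simp [(RingHom.mem_ker).1 he], fun h => ?_⟩
  have h1 := hxe (h - algebraMap k R (χ h)) (by simp [RingHom.mem_ker])
  rw [Algebra.smul_def]
  rw [sub_mul, sub_eq_iff_eq_add] at h1
  rw [mul_sub, mul_sub, mul_one, mul_one, h1]
  abel

variable (k H : Type*) [Field k] [Ring H] [HopfAlgebra k H]

/-- A two-sided integral of augmentation one. -/
structure IsNormalizedIntegral {k H : Type*} [Field k] [Ring H] [HopfAlgebra k H] (L : H) :
    Prop where
  counit_eq : counit (R := k) L = 1
  mul_left : ∀ h : H, h * L = counit (R := k) h • L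
  mul_right : ∀ h : H, L * h = counit (R := k) h • L

theorem exists_isNormalizedIntegral [IsSemisimpleRing H] :
    ∃ L : H, IsNormalizedIntegral (k := k) L := by
  obtain ⟨l, hl1, hl⟩ := IsSemisimpleRing.exists_mul_eq_smul (Bialgebra.counitAlgHom k H)
  obtain ⟨r, hr1, hr⟩ := IsSemisimpleRing.exists_mul_eq_smul
    (AlgHom.fromOpposite (Bialgebra.counitAlgHom k H) fun _ _ => Commute.all _ _)
  have hr' : ∀ h, r.unop * h = counit (R := k) h • r.unop := fun h =>
    MulOpposite.op_injective (by simpa using hr (MulOpposite.op h))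
  have hr1' : counit (R := k) r.unop = 1 := by simpa using hr1
  -- The product of the normalized right and left integrals equals each of them.
  have h1 : r.unop = l := by
    have := hr' l
    rw [hl r.unop] at this
    simpa [hr1', show counit (R := k) l = 1 by simpa using hl1] using this.symm
  exact ⟨l, by simpa using hl1, by simpa using hl, h1 ▸ hr'⟩

variable {k H} {M : Type*} [AddCommGroup M] [Module k M]

theorem sw_isBilin_linear {F : H → H → M} (hF : IsBilin k F) : IsLinearMap k (sw k F) :=
  ⟨sw_add hF, sw_smul hF⟩

namespace IsNormalizedIntegral

variable {L : H} (hL : IsNormalizedIntegral (k := k) L)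
include hL

/-- The Casimir property of ∑ S(L₁) ⊗ L₂. Evaluate ∑ h₁S(h₂)S(L₁) ⊗ L₂h₃ in two ways: cancel
h₁S(h₂), or recognize S(L₁h₂) ⊗ L₂h₃ as coming from Δ(Lh₂) = ε(h₂)Δ(L). -/
theorem sw_mul_antipode {F : H → H → M} (hF : IsBilin k F) (h : H) :
    sw k (fun x y => F (h * antipode k x) y) L = sw k (fun x y => F (antipode k x) (y * h)) L := by
  have key := sw_assoc (k := k) (T := fun p q r =>
    sw k (fun x y => F (p * antipode k q * antipode k x) (y * r)) L)
    (by constructor <;> intros <;>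
      simp [sw, mul_add, add_mul, hF.add_left, hF.add_right, hF.smul_left, hF.smul_right,
        Finset.sum_add_distrib, Finset.smul_sum]) h
  have e1 : ∀ x y : H, sw k (fun p q => sw k (fun x' y' =>
      F (p * antipode k q * antipode k x') (y' * y)) L) x =
      counit (R := k) x • sw k (fun x' y' => F (antipode k x') (y' * y)) L := by
    intro x y
    rw [sw_antipode_right (f := fun t => sw k (fun x' y' => F (t * antipode k x') (y' * y)) L)]
    · simp
    · constructor <;> intros <;>
        simp [sw, add_mul, hF.add_left, hF.smul_left,
          Finset.sum_add_distrib, Finset.smul_sum]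
  have e2 : ∀ x y : H, sw k (fun p q => sw k (fun x' y' =>
      F (x * antipode k p * antipode k x') (y' * q)) L) y =
      counit (R := k) y • sw k (fun x' y' => F (x * antipode k x') y') L := by
    intro x y
    have hB : IsBilin k (fun x' y' => F (x * antipode k x') y') := by
      constructor <;> intros <;>
        simp [mul_add, hF.add_left, hF.add_right, hF.smul_left, hF.smul_right]
    rw [← sw_smul hB, ← hL.mul_right, sw_comul_mul hB, sw_comm]
    simp [antipode_mul_antidistrib, mul_assoc]
  simp only [e1, e2] at key
  rw [sw_counit_left, sw_counit_right] at key
  · exact key.symm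
  · constructor <;> intros <;>
      simp [sw, add_mul, hF.add_left, hF.smul_left, Finset.sum_add_distrib, Finset.smul_sum]
  · constructor <;> intros <;>
      simp [sw, mul_add, hF.add_right, hF.smul_right, Finset.sum_add_distrib, Finset.smul_sum]

/-- Evaluate ∑ S(h₁)h₂L₁ ⊗ h₃L₂ in two ways, now using Δ(hL) = ε(h)Δ(L). -/
theorem sw_mul_right {F : H → H → M} (hF : IsBilin k F) (h : H) :
    sw k (fun x y => F x (h * y)) L = sw k (fun x y => F (antipode k h * x) y) L := by
  have key := sw_assoc (k := k) (T := fun p q r =>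
    sw k (fun x y => F (antipode k p * q * x) (r * y)) L)
    (by constructor <;> intros <;>
      simp [sw, mul_add, add_mul, hF.add_left, hF.add_right, hF.smul_left, hF.smul_right,
        Finset.sum_add_distrib, Finset.smul_sum]) h
  have e1 : ∀ x y : H, sw k (fun p q => sw k (fun x' y' =>
      F (antipode k p * q * x') (y * y')) L) x =
      counit (R := k) x • sw k (fun x' y' => F x' (y * y')) L := by
    intro x y
    rw [sw_antipode_left (f := fun t => sw k (fun x' y' => F (t * x') (y * y')) L)]
    · simp
    · constructor <;> intros <;>
        simp [sw, add_mul, hF.add_left, hF.smul_left,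
          Finset.sum_add_distrib, Finset.smul_sum]
  have e2 : ∀ x y : H, sw k (fun p q => sw k (fun x' y' =>
      F (antipode k x * p * x') (q * y')) L) y =
      counit (R := k) y • sw k (fun x' y' => F (antipode k x * x') y') L := by
    intro x y
    have hB : IsBilin k (fun x' y' => F (antipode k x * x') y') := by
      constructor <;> intros <;>
        simp [mul_add, hF.add_left, hF.add_right, hF.smul_left, hF.smul_right]
    rw [← sw_smul hB, ← hL.mul_left, sw_comul_mul hB]
    simp [mul_assoc]
  simp only [e1, e2] at key
  rw [sw_counit_left, sw_counit_right] at key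
  · exact key
  · constructor <;> intros <;>
      simp [sw, add_mul, hF.add_left, hF.smul_left, Finset.sum_add_distrib, Finset.smul_sum]
  · constructor <;> intros <;>
      simp [sw, add_mul, hF.add_right, hF.smul_right, Finset.sum_add_distrib, Finset.smul_sum]

theorem sw_antipode_mul_mul (h : H) :
    sw k (fun x y => antipode k x * y * h) L = h := by
  rw [← sw_mul, sw, sum_antipode_mul_eq_smul, hL.counit_eq, one_smul, one_mul]

/-- The Casimir element gives h = ∑ hS(L₁)π(L₂) = ∑ S(L₁)π(L₂h), with π a projection onto the span W
of the finitely many L₂. So H is a linear image of finitely many copies of W. -/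
theorem finite : Module.Finite k H := by
  classical
  let r := ℛ k L
  let W : Submodule k H := Submodule.span k (r.index.image r.right : Set H)
  obtain ⟨π, hπ⟩ := W.subtype.exists_leftInverse_of_injective W.ker_subtype
  have hπ' : ∀ i ∈ r.index, (π (r.right i) : H) = r.right i := fun i hi =>
    congrArg Subtype.val (LinearMap.congr_fun hπ
      ⟨r.right i, Submodule.subset_span (by simpa using ⟨_, _, hi, rfl⟩)⟩)
  have key : ∀ h : H, h = ∑ i ∈ r.index, antipode k (r.left i) * (π (r.right i * h) : H) := by
    intro h
    have h1 := hL.sw_mul_antipode (F := fun x y => x * (π y : H))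
      (by constructor <;> intros <;> simp [add_mul, mul_add]) h
    refine Eq.trans ?_ h1
    have h2 := congrArg (h * ·) (hL.sw_antipode_mul_mul 1)
    simp only [mul_one] at h2
    refine h2.symm.trans ((mul_sw ..).trans ?_)
    refine Finset.sum_congr rfl fun i hi => ?_
    simp only [← mul_assoc]
    rw [hπ' i hi]
  let T : (r.index → W) →ₗ[k] H :=
    ∑ i : r.index, LinearMap.mulLeft k (antipode k (r.left i)) ∘ₗ W.subtype ∘ₗ LinearMap.proj i
  have : Module.Finite k W := Module.Finite.span_of_finite k (Finset.finite_toSet _)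
  refine Module.Finite.of_surjective T fun h => ⟨fun i => π (r.right i * h), ?_⟩
  conv_rhs => rw [key h, ← Finset.sum_coe_sort]
  simp [T]

/-- The kernel of S is a right ideal, so it has a left identity e. For h in it, h = ∑ S(L₁)L₂h = ∑
S(L₁)eL₂h, and moving e to the first factor produces S(S(e)L₁) = 0. -/
theorem antipode_injective [IsSemisimpleRing H] : Function.Injective (antipode k : H →ₗ[k] H) := by
  rw [injective_iff_map_eq_zero]
  intro h hh
  let I : Ideal Hᵐᵒᵖ :=
    { carrier := {x | antipode k x.unop = 0}
      add_mem' := by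
        intro a b ha hb
        simp only [Set.mem_ofPred_eq] at *
        simp [ha, hb]
      zero_mem' := by simp
      smul_mem' := by
        intro c x hx
        simp only [Set.mem_ofPred_eq] at *
        simp [antipode_mul_antidistrib, hx] }
  obtain ⟨e, he, hxe⟩ := IsSemisimpleRing.exists_right_identity I
  have he' : antipode k e.unop = 0 := he
  have h1 : ∀ x : H, antipode k x = 0 → e.unop * x = x := fun x hx =>
    MulOpposite.op_injective (hxe (MulOpposite.op x) hx)
  rw [← hL.sw_antipode_mul_mul h]
  have h2 : ∀ y : H, e.unop * y * h = y * h := fun y => by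
    rw [mul_assoc]
    exact h1 _ (by simp [antipode_mul_antidistrib, hh])
  have h3 := hL.sw_mul_right (F := fun x y => antipode k x * (y * h))
    (by constructor <;> intros <;> simp [add_mul, mul_add]) e.unop
  simp only [h2, he', zero_mul, map_zero, sw_zero] at h3
  simpa only [mul_assoc] using h3

end IsNormalizedIntegral

section Inverse

variable {Sinv : H →ₗ[k] H}

/-- Applying the injective antimultiplicative S turns this into an antipode axiom. -/
theorem sw_mul_antipode_inv (hinj : Function.Injective (antipode k : H →ₗ[k] H))
    (hS : ∀ h, antipode k (Sinv h) = h) {f : H → M} (hf : IsLinearMap k f) (h : H) :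
    sw k (fun x y => f (y * Sinv x)) h = counit (R := k) h • f 1 := by
  have : sw k (fun x y => y * Sinv x) h = counit (R := k) h • (1 : H) := by
    apply hinj
    rw [map_sw]
    simp only [antipode_mul_antidistrib, hS]
    rw [sw, sum_mul_antipode_eq_smul]
    simp
  simp_rw [← hf.mk'_apply]
  rw [← map_sw (hf.mk' f), this, map_smul]

theorem sw_antipode_inv_mul (hinj : Function.Injective (antipode k : H →ₗ[k] H))
    (hS : ∀ h, antipode k (Sinv h) = h) {f : H → M} (hf : IsLinearMap k f) (h : H) :
    sw k (fun x y => f (Sinv y * x)) h = counit (R := k) h • f 1 := by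
  have : sw k (fun x y => Sinv y * x) h = counit (R := k) h • (1 : H) := by
    apply hinj
    rw [map_sw]
    simp only [antipode_mul_antidistrib, hS]
    rw [sw, sum_antipode_mul_eq_smul]
    simp
  simp_rw [← hf.mk'_apply]
  rw [← map_sw (hf.mk' f), this, map_smul]

theorem exists_antipode_inv [Module.Finite k H]
    (hinj : Function.Injective (antipode k : H →ₗ[k] H)) :
    ∃ Sinv : H →ₗ[k] H, ∀ h, antipode k (Sinv h) = h :=
  ⟨(LinearEquiv.ofInjectiveEndo _ hinj).symm.toLinearMap, fun h =>
    (LinearEquiv.ofInjectiveEndo _ hinj).apply_symm_apply h⟩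

end Inverse

end Integral

/-! ### The adjoint action -/

section Adjoint

variable {k H R : Type*} [Field k] [Ring H] [HopfAlgebra k H] [Ring R] [Algebra k R]
  (j : H →ₐ[k] R)

/-- The adjoint action `(h, b) ↦ ∑ j(h₁) b j(S(h₂))`. -/
noncomputable def adj : H →ₗ[k] R →ₗ[k] R :=
  LinearMap.mk₂ k (fun h b => sw k (fun x y => j x * b * j (antipode k y)) h)
    (fun h h' b => sw_add (by constructor <;> intros <;> simp [add_mul, mul_add]) h h')
    (fun c h b => sw_smul (by constructor <;> intros <;> simp [add_mul, mul_add]) c h)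
    (fun h b b' => by simp [sw, mul_add, add_mul, Finset.sum_add_distrib])
    (fun c h b => by simp [sw, Finset.smul_sum])

theorem adj_apply (h : H) (b : R) :
    adj j h b = sw k (fun x y => j x * b * j (antipode k y)) h := rfl

theorem adj_one_left (b : R) : adj j 1 b = b := by
  rw [adj_apply, sw_one (by constructor <;> intros <;> simp [add_mul, mul_add])]
  simp

theorem adj_one_right (h : H) : adj j h 1 = counit (R := k) h • (1 : R) := by
  rw [adj_apply]
  simp only [mul_one, ← map_mul]
  rw [sw_antipode_right (f := j) ⟨map_add j, map_smul j⟩, map_one]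

/-- The commutation rule that moves j(h) past b: the inner S(h₂)h₃ cancels. -/
theorem sw_adj_mul (h : H) (b : R) : sw k (fun x y => adj j x b * j y) h = j h * b := by
  have key := sw_assoc (k := k) (T := fun x y z => j x * b * j (antipode k y) * j z)
    (by constructor <;> intros <;> simp [add_mul, mul_add]) h
  simp only [← sw_mul, ← adj_apply] at key
  rw [key]
  simp only [mul_assoc, ← map_mul, ← mul_sw]
  have : ∀ y, sw k (fun p q => j (antipode k p * q)) y = counit (R := k) y • (1 : R) := fun y => by
    rw [sw_antipode_left (f := j) ⟨map_add j, map_smul j⟩, map_one]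
  simp only [this, mul_smul_comm, mul_one]
  exact sw_counit_right (f := fun t => j t * b)
    (by constructor <;> intros <;> simp [add_mul]) h

theorem sw_antipode_mul_adj (h : H) (b : R) :
    sw k (fun x y => j (antipode k x) * adj j y b) h = b * j (antipode k h) := by
  have key := sw_assoc (k := k) (T := fun x y z => j (antipode k x) * (j y * b * j (antipode k z)))
    (by constructor <;> intros <;> simp [add_mul, mul_add]) h
  simp only [← mul_sw, ← adj_apply] at key
  rw [← key]
  simp only [← mul_assoc, ← map_mul, ← sw_mul]
  have : ∀ y, sw k (fun p q => j (antipode k p * q)) y = counit (R := k) y • (1 : R) := fun y => by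
    rw [sw_antipode_left (f := j) ⟨map_add j, map_smul j⟩, map_one]
  simp only [this, smul_mul_assoc, one_mul]
  exact sw_counit_left (f := fun t => b * j (antipode k t))
    (by constructor <;> intros <;> simp [mul_add]) h

theorem adj_mul (h : H) (a b : R) :
    adj j h (a * b) = sw k (fun x y => adj j x a * adj j y b) h := by
  have key := sw_assoc (k := k) (T := fun x y z => adj j x a * j y * b * j (antipode k z))
    (by constructor <;> intros <;> simp [add_mul, mul_add]) h
  simp only [← sw_mul, sw_adj_mul] at key
  simp only [mul_assoc, ← mul_sw] at key
  simp only [← mul_assoc] at key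
  simpa only [adj_apply, mul_assoc] using key

theorem adj_adj (h g : H) (b : R) : adj j h (adj j g b) = adj j (h * g) b := by
  rw [adj_apply j (h * g), sw_comul_mul (by constructor <;> intros <;> simp [add_mul, mul_add]),
    adj_apply]
  refine sw_congr _ fun x y => ?_
  rw [adj_apply, mul_sw, sw_mul]
  simp [antipode_mul_antidistrib, mul_assoc]

end Adjoint

/-! ### Counting homomorphisms: a projectivity criterion -/

section HomCount

set_option linter.unusedSectionVars false

open Module

instance Submodule.finiteDimensional_of_tower {k B N : Type*} [Field k] [Ring B] [Algebra k B]
    [AddCommGroup N] [Module k N] [Module B N] [IsScalarTower k B N] [FiniteDimensional k N]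
    (U : Submodule B N) : FiniteDimensional k U :=
  inferInstanceAs (FiniteDimensional k (U.restrictScalars k))

variable {k B M : Type*} [Field k] [Ring B] [Algebra k B]
  [AddCommGroup M] [Module k M] [Module B M] [IsScalarTower k B M] [FiniteDimensional k M]

section

variable {N N' : Type*} [AddCommGroup N] [Module k N] [Module B N] [IsScalarTower k B N]
  [AddCommGroup N'] [Module k N'] [Module B N'] [IsScalarTower k B N']

theorem finrank_hom_congr (e : N ≃ₗ[B] N') :
    finrank k (M →ₗ[B] N) = finrank k (M →ₗ[B] N') :=
  (LinearEquiv.ofLinearMap (LinearMap.compRight k e.toLinearMap)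
    (LinearMap.compRight k e.symm.toLinearMap)
    (by ext; simp) (by ext; simp)).finrank_eq

variable [FiniteDimensional k N] [FiniteDimensional k N']

/-- Left exactness of Hom(M, -), in terms of dimensions. -/
theorem finrank_range_compRight_subtype (U : Submodule B N) :
    finrank k (LinearMap.ker (LinearMap.compRight k (M := M) U.mkQ)) =
      finrank k (M →ₗ[B] U) := by
  have h1 : LinearMap.ker (LinearMap.compRight k (M := M) U.mkQ) =
      LinearMap.range (LinearMap.compRight k (M := M) U.subtype) := by
    ext f
    constructor
    · intro hf
      refine ⟨f.codRestrict U fun m => ?_, by ext; rfl⟩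
      simpa using LinearMap.congr_fun hf m
    · rintro ⟨g, rfl⟩
      ext m
      simp
  rw [h1]
  refine LinearMap.finrank_range_of_inj fun f g hfg => ?_
  ext m
  exact LinearMap.congr_fun hfg m

theorem finrank_hom_le_add (U : Submodule B N) :
    finrank k (M →ₗ[B] N) ≤ finrank k (M →ₗ[B] U) + finrank k (M →ₗ[B] N ⧸ U) := by
  rw [← LinearMap.finrank_range_add_finrank_ker (LinearMap.compRight k (M := M) U.mkQ),
    finrank_range_compRight_subtype, add_comm]
  gcongr
  exact Submodule.finrank_le _

theorem finrank_submodule_add (U : Submodule B N) :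
    finrank k U + finrank k (N ⧸ U) = finrank k N := by
  rw [add_comm]
  exact Submodule.finrank_quotient_add_finrank (U.restrictScalars k)

end

variable {n d : ℕ}

section Bound

variable (hmax : ∀ I : Ideal B, IsCoatom I →
    d * finrank k (M →ₗ[B] B ⧸ I) ≤ n * finrank k (B ⧸ I))

include hmax

/-- The bound passes from simple modules to all finite-dimensional ones by peeling off a simple
submodule: dim Hom(M, -) is subadditive and dimension is additive. -/
theorem mul_finrank_hom_le {N : Type*} [AddCommGroup N] [Module k N] [Module B N]
    [IsScalarTower k B N] [FiniteDimensional k N] :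
    d * finrank k (M →ₗ[B] N) ≤ n * finrank k N := by
  obtain ⟨l, hl⟩ : ∃ l, finrank k N = l := ⟨_, rfl⟩
  induction l using Nat.strong_induction_on generalizing N with
  | _ l ih =>
  rcases subsingleton_or_nontrivial N with hN | hN
  · simp [finrank_zero_of_subsingleton]
  · have : IsArtinian B N := isArtinian_of_tower k inferInstance
    obtain ⟨U, hU⟩ := IsAtomic.exists_atom (Submodule B N)
    have hUs : IsSimpleModule B U := isSimpleModule_iff_isAtom.2 hU
    obtain ⟨I, hI, ⟨e⟩⟩ := isSimpleModule_iff_quot_maximal.1 hUs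
    have h1 : d * finrank k (M →ₗ[B] U) ≤ n * finrank k U := by
      rw [finrank_hom_congr e, (e.restrictScalars k).finrank_eq]
      exact hmax I hI.out
    have h2 := finrank_submodule_add (k := k) U
    have : Nontrivial U := hUs.nontrivial
    have h3 : 0 < finrank k U := finrank_pos
    have h4 := ih _ (by omega) (N := N ⧸ U) rfl
    calc _ ≤ d * (finrank k (M →ₗ[B] U) + finrank k (M →ₗ[B] N ⧸ U)) := by
          gcongr; exact finrank_hom_le_add U
      _ ≤ n * (finrank k U + finrank k (N ⧸ U)) := by rw [mul_add, mul_add]; omega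
      _ = _ := by rw [h2]

variable {N : Type*} [AddCommGroup N] [Module k N] [Module B N]
    [IsScalarTower k B N] [FiniteDimensional k N]

/-- Call N tight when it attains the bound. The bounds for U and N/U add up to the one for N, so
equality for N forces equality in both. -/
theorem tight_submodule_quotient (hN : d * finrank k (M →ₗ[B] N) = n * finrank k N)
    (U : Submodule B N) :
    d * finrank k (M →ₗ[B] U) = n * finrank k U ∧
      d * finrank k (M →ₗ[B] N ⧸ U) = n * finrank k (N ⧸ U) := by
  have h1 := mul_finrank_hom_le hmax (N := U)
  have h2 := mul_finrank_hom_le hmax (N := N ⧸ U)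
  have h3 := Nat.mul_le_mul_left d (finrank_hom_le_add (k := k) (M := M) U)
  rw [hN, ← finrank_submodule_add (k := k) U] at h3
  rw [mul_add, mul_add] at h3
  omega

theorem tight_of_injective {N' : Type*} [AddCommGroup N'] [Module k N'] [Module B N']
    [IsScalarTower k B N'] (hN : d * finrank k (M →ₗ[B] N) = n * finrank k N)
    (f : N' →ₗ[B] N) (hf : Function.Injective f) :
    d * finrank k (M →ₗ[B] N') = n * finrank k N' := by
  have e := LinearEquiv.ofInjective f hf
  rw [finrank_hom_congr e, (e.restrictScalars k).finrank_eq]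
  exact (tight_submodule_quotient hmax hN _).1

theorem tight_of_surjective {N' : Type*} [AddCommGroup N'] [Module k N'] [Module B N']
    [IsScalarTower k B N'] (hN : d * finrank k (M →ₗ[B] N) = n * finrank k N)
    (f : N →ₗ[B] N') (hf : Function.Surjective f) :
    d * finrank k (M →ₗ[B] N') = n * finrank k N' := by
  have e := f.quotKerEquivOfSurjective hf
  rw [← finrank_hom_congr e, ← (e.restrictScalars k).finrank_eq]
  exact (tight_submodule_quotient hmax hN _).2

theorem tight_pi {ι : Type*} [Fintype ι] (hN : d * finrank k (M →ₗ[B] N) = n * finrank k N) :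
    d * finrank k (M →ₗ[B] (ι → N)) = n * finrank k (ι → N) := by
  refine (mul_finrank_hom_le hmax).antisymm ?_
  let T : (ι → (M →ₗ[B] N)) →ₗ[k] (M →ₗ[B] (ι → N)) :=
    { toFun := LinearMap.pi
      map_add' := fun _ _ => rfl
      map_smul' := fun _ _ => rfl }
  have h1 : finrank k (ι → (M →ₗ[B] N)) ≤ finrank k (M →ₗ[B] (ι → N)) :=
    LinearMap.finrank_le_finrank_of_injective (f := T) fun f g hfg => by
      funext i
      ext m
      exact congrFun (LinearMap.congr_fun hfg m) i
  rw [finrank_pi_fintype] at h1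
  rw [finrank_pi_fintype]
  simp only [Finset.sum_const, smul_eq_mul] at h1 ⊢
  calc n * (Finset.univ.card * finrank k N) = Finset.univ.card * (n * finrank k N) := by ring
    _ = d * (Finset.univ.card * finrank k (M →ₗ[B] N)) := by rw [← hN]; ring
    _ ≤ _ := by gcongr

omit hmax in
theorem exists_injective_pi_of_faithful {X : Type*} [AddCommGroup X] [Module k X] [Module B X]
    [IsScalarTower k B X] [FiniteDimensional k X]
    (hfaith : ∀ b : B, (∀ x : X, b • x = 0) → b = 0) :
    ∃ (m : ℕ) (f : B →ₗ[B] (Fin m → X)), Function.Injective f := by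
  obtain ⟨m, ⟨b⟩⟩ : ∃ m, Nonempty (Basis (Fin m) k X) := ⟨_, ⟨Module.finBasis k X⟩⟩
  refine ⟨m, LinearMap.pi fun i => LinearMap.toSpanSingleton B X (b i), ?_⟩
  rw [injective_iff_map_eq_zero]
  intro c hc
  refine hfaith c fun x => ?_
  have : Algebra.lsmul k k X c = 0 := b.ext fun i => by simpa using congrFun hc i
  exact LinearMap.congr_fun this x

/-- If some faithful finite-dimensional module is tight then so are all of them. -/
theorem tight_of_faithful {X : Type*} [AddCommGroup X] [Module k X] [Module B X]
    [IsScalarTower k B X] [FiniteDimensional k X]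
    (hX : d * finrank k (M →ₗ[B] X) = n * finrank k X)
    (hfaith : ∀ b : B, (∀ x : X, b • x = 0) → b = 0) :
    d * finrank k (M →ₗ[B] N) = n * finrank k N := by
  -- Tightness travels from X to powers of X, to the submodule B, to free modules, and to the
  -- quotient N.
  obtain ⟨m, f, hf⟩ := exists_injective_pi_of_faithful (k := k) hfaith
  have : FiniteDimensional k B := Module.Finite.of_injective (f.restrictScalars k) hf
  have h0 : d * finrank k (M →ₗ[B] (Fin m → X)) = n * finrank k (Fin m → X) :=
    tight_pi hmax hX
  have h1 : d * finrank k (M →ₗ[B] B) = n * finrank k B :=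
    tight_of_injective hmax h0 f hf
  have : Module.Finite B N := Module.Finite.of_restrictScalars_finite k B N
  obtain ⟨m, g, hg⟩ := Module.Finite.exists_fin' B N
  have h2 : d * finrank k (M →ₗ[B] (Fin m → B)) = n * finrank k (Fin m → B) :=
    tight_pi hmax h1
  exact tight_of_surjective hmax h2 g hg

/-- For a free cover F → M with kernel U, tightness of U, F and F/U makes dim Hom(M, -) additive.
Hence Hom(M, F) → Hom(M, F/U) is onto, and M ≅ F/U lifts to a splitting. -/
theorem projective_of_tight (hd : 0 < d) {X : Type*} [AddCommGroup X] [Module k X] [Module B X]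
    [IsScalarTower k B X] [FiniteDimensional k X]
    (hX : d * finrank k (M →ₗ[B] X) = n * finrank k X)
    (hfaith : ∀ b : B, (∀ x : X, b • x = 0) → b = 0) [FiniteDimensional k B] :
    Module.Projective B M := by
  have : Module.Finite B M := Module.Finite.of_restrictScalars_finite k B M
  obtain ⟨m, g, hg⟩ := Module.Finite.exists_fin' B M
  let U := LinearMap.ker g
  have hU : d * finrank k (M →ₗ[B] U) = n * finrank k U := tight_of_faithful hmax hX hfaith
  have hQ : d * finrank k (M →ₗ[B] (Fin m → B) ⧸ U) = n * finrank k ((Fin m → B) ⧸ U) :=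
    tight_of_faithful hmax hX hfaith
  have hF : d * finrank k (M →ₗ[B] (Fin m → B)) = n * finrank k (Fin m → B) :=
    tight_of_faithful hmax hX hfaith
  have h1 := LinearMap.finrank_range_add_finrank_ker (LinearMap.compRight k (M := M) U.mkQ)
  rw [finrank_range_compRight_subtype] at h1
  rw [← finrank_submodule_add (k := k) U, mul_add, ← hU, ← hQ, ← mul_add] at hF
  have h2 := Nat.eq_of_mul_eq_mul_left hd hF
  have h3 : LinearMap.range (LinearMap.compRight k (M := M) U.mkQ) = ⊤ :=
    Submodule.eq_top_of_finrank_eq (by omega)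
  let e := g.quotKerEquivOfSurjective hg
  obtain ⟨s, hs⟩ := LinearMap.range_eq_top.1 h3 e.symm.toLinearMap
  refine Module.Projective.of_split s g ?_
  ext x
  have h4 := congrArg e (LinearMap.congr_fun hs x)
  simpa [e, U] using h4

end Bound

/-- There is a maximal left ideal `I` maximizing `dim Hom(M, B/I) / dim (B/I)`. -/
theorem exists_max_hom_ratio [FiniteDimensional k B] [Nontrivial B] :
    ∃ I : Ideal B, IsCoatom I ∧ ∀ J : Ideal B, IsCoatom J →
      finrank k (B ⧸ I) * finrank k (M →ₗ[B] B ⧸ J) ≤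
        finrank k (M →ₗ[B] B ⧸ I) * finrank k (B ⧸ J) := by
  let T : Set ℚ := {q | ∃ I : Ideal B, IsCoatom I ∧
    q = (finrank k (M →ₗ[B] B ⧸ I) : ℚ) / finrank k (B ⧸ I)}
  -- Numerators and denominators are bounded, so only finitely many ratios occur.
  have hT : T.Finite := by
    refine ((Set.finite_Iic (finrank k M * finrank k B)).image2
      (fun a b : ℕ => (a : ℚ) / b) (Set.finite_Iic (finrank k B))).subset ?_
    rintro _ ⟨I, hI, rfl⟩
    have h0 : finrank k (B ⧸ I) ≤ finrank k B := Submodule.finrank_quotient_le (I.restrictScalars k)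
    refine ⟨_, ?_, _, h0, rfl⟩
    refine le_trans (LinearMap.finrank_le_finrank_of_injective
      (f := LinearMap.restrictScalarsₗ k B M (B ⧸ I) k) (LinearMap.restrictScalars_injective k)) ?_
    rw [finrank_linearMap]
    gcongr
  obtain ⟨I₀, hI₀⟩ := Ideal.exists_maximal B
  obtain ⟨_, ⟨I, hI, rfl⟩, hmax⟩ := hT.exists_maximal ⟨_, I₀, hI₀.out, rfl⟩
  refine ⟨I, hI, fun J hJ => ?_⟩
  have hpos : ∀ J : Ideal B, IsCoatom J → 0 < finrank k (B ⧸ J) := fun J hJ => by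
    have : Nontrivial (B ⧸ J) := Submodule.Quotient.nontrivial_iff.2 hJ.1
    exact finrank_pos
  have h1 : (finrank k (M →ₗ[B] B ⧸ J) : ℚ) / finrank k (B ⧸ J) ≤
      (finrank k (M →ₗ[B] B ⧸ I) : ℚ) / finrank k (B ⧸ I) := by
    rcases le_total ((finrank k (M →ₗ[B] B ⧸ J) : ℚ) / finrank k (B ⧸ J))
      ((finrank k (M →ₗ[B] B ⧸ I) : ℚ) / finrank k (B ⧸ I)) with h | h
    · exact h
    · exact hmax ⟨J, hJ, rfl⟩ h
  have h2 : (0 : ℚ) < finrank k (B ⧸ I) := by exact_mod_cast hpos I hI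
  have h3 : (0 : ℚ) < finrank k (B ⧸ J) := by exact_mod_cast hpos J hJ
  rw [div_le_div_iff₀ h3 h2] at h1
  rw [mul_comm]
  exact_mod_cast h1

end HomCount

/-! ### Coinduced modules -/

section Coinduced

open Module

set_option linter.unusedSectionVars false

variable {k H R : Type*} [Field k] [Ring H] [HopfAlgebra k H] [Ring R] [Algebra k R]
  {j : H →ₐ[k] R} {B : Subalgebra k R} (hB : ∀ h : H, ∀ b ∈ B, adj j h b ∈ B)

/-- The adjoint action on a stable subalgebra. -/
noncomputable def adjSub : H →ₗ[k] B →ₗ[k] B :=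
  LinearMap.mk₂ k (fun h b => ⟨adj j h b, hB h b b.2⟩)
    (fun _ _ _ => Subtype.ext (by simp)) (fun _ _ _ => Subtype.ext (by simp))
    (fun _ _ _ => Subtype.ext (by simp)) (fun _ _ _ => Subtype.ext (by simp))

@[simp]
theorem coe_adjSub (h : H) (b : B) : (adjSub hB h b : R) = adj j h b := rfl

theorem adjSub_mul (h : H) (a b : B) :
    adjSub hB h (a * b) = sw k (fun x y => adjSub hB x a * adjSub hB y b) h := by
  apply Subtype.ext
  rw [coe_adjSub, Subalgebra.coe_mul, adj_mul, ← Subalgebra.coe_val, map_sw]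
  rfl

theorem adjSub_one (h : H) : adjSub hB h 1 = counit (R := k) h • (1 : B) :=
  Subtype.ext (by simp [adj_one_right])

variable (V : Type*) [AddCommGroup V] [Module k V] [Module B V] [IsScalarTower k B V]

/-- The `B`-module coinduced from `V`: the space of linear maps `H → V`, with
`(b f) h = ∑ (h₁ · b) f(h₂)`. -/
@[nolint unusedArguments]
def Coind (_hB : ∀ h : H, ∀ b ∈ B, adj j h b ∈ B) (V : Type*) [AddCommGroup V] [Module k V] :
    Type _ := H →ₗ[k] V

noncomputable instance : AddCommGroup (Coind hB V) := inferInstanceAs (AddCommGroup (H →ₗ[k] V))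

noncomputable instance : Module k (Coind hB V) := inferInstanceAs (Module k (H →ₗ[k] V))

instance [FiniteDimensional k H] [FiniteDimensional k V] : FiniteDimensional k (Coind hB V) :=
  inferInstanceAs (FiniteDimensional k (H →ₗ[k] V))

variable {V}

/-- The linear map underlying an element of the coinduced module. -/
def Coind.toLin {hB : ∀ h : H, ∀ b ∈ B, adj j h b ∈ B} (f : Coind hB V) : H →ₗ[k] V := f

theorem Coind.ext {hB : ∀ h : H, ∀ b ∈ B, adj j h b ∈ B} {f g : Coind hB V} (h : ∀ x, f.toLin x = g.toLin x) : f = g :=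
  LinearMap.ext h

theorem isBilin_adjSub_smul (b : B) (f : H →ₗ[k] V) :
    IsBilin k (fun x y => adjSub hB x b • f y) := by
  constructor <;> intros <;> simp [add_smul, smul_algebra_smul_comm]

noncomputable instance : SMul B (Coind hB V) :=
  ⟨fun b f => (sw_isBilin_linear (isBilin_adjSub_smul hB b f.toLin)).mk'⟩

theorem Coind.smul_apply (b : B) (f : Coind hB V) (h : H) :
    (b • f).toLin h = sw k (fun x y => adjSub hB x b • f.toLin y) h := rfl

@[simp]
theorem Coind.add_apply (f g : Coind hB V) (h : H) :
    (f + g).toLin h = f.toLin h + g.toLin h := rfl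

@[simp]
theorem Coind.zero_apply (h : H) : (0 : Coind hB V).toLin h = 0 := rfl

@[simp]
theorem Coind.field_smul_apply (c : k) (f : Coind hB V) (h : H) :
    (c • f).toLin h = c • f.toLin h := rfl

noncomputable instance : Module B (Coind hB V) where
  one_smul f := Coind.ext fun h => by
    simp only [Coind.smul_apply, adjSub_one, smul_assoc, one_smul]
    exact sw_counit_left (f := fun t => f.toLin t) ⟨map_add _, map_smul _⟩ h
  mul_smul a b f := Coind.ext fun h => by
    have key := sw_assoc (k := k)
      (T := fun x y z => (adjSub hB x a * adjSub hB y b) • f.toLin z)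
      (by constructor <;> intros <;> simp [add_smul, add_mul, mul_add, smul_algebra_smul_comm]) h
    simp only [← sw_smul_vec, ← adjSub_mul] at key
    refine key.trans ?_
    rw [Coind.smul_apply]
    refine sw_congr _ fun x y => ?_
    simp only [mul_smul, ← smul_sw, Coind.smul_apply]
  smul_zero b := Coind.ext fun h => by simp [Coind.smul_apply, sw_zero]
  zero_smul f := Coind.ext fun h => by simp [Coind.smul_apply, sw_zero]
  smul_add b f g := Coind.ext fun h => by
    simp [Coind.smul_apply, sw, Finset.sum_add_distrib]
  add_smul a b f := Coind.ext fun h => by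
    simp [Coind.smul_apply, sw, Finset.sum_add_distrib, add_smul]

instance : IsScalarTower k B (Coind hB V) := ⟨fun c b f => Coind.ext fun h => by
  simp [Coind.smul_apply, sw, Finset.smul_sum]⟩

/-- On the function f = ε(-)v one has (bf)(h) = (h·b)v. -/
theorem Coind.faithful (hV : ∀ b : B, (∀ (h : H) (v : V), adjSub hB h b • v = 0) → b = 0)
    (b : B) (hb : ∀ f : Coind hB V, b • f = 0) : b = 0 := by
  refine hV b fun h v => ?_
  let f : Coind hB V := ((counit (R := k) (A := H)).smulRight v : H →ₗ[k] V)
  have hf : ∀ y, f.toLin y = counit (R := k) y • v := fun y => rfl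
  have h1 : (b • f).toLin h = 0 := by rw [hb]; rfl
  rw [← sw_counit_right (k := k) (f := fun t => adjSub hB t b • v)
    (by constructor <;> intros <;> simp [add_smul]), ← h1, Coind.smul_apply]
  simp only [hf, smul_algebra_smul_comm]

variable {M : Type*} [AddCommGroup M] [Module k M] [Module R M] [IsScalarTower k R M]

/-- The map `Hom(H, Hom(M, V)) → Hom(M, Coind V)`. -/
noncomputable def Coind.ofHom : (H →ₗ[k] (M →ₗ[B] V)) →ₗ[k] (M →ₗ[B] Coind hB V) where
  toFun G :=
    { toFun := fun m => (sw_isBilin_linear (F := fun x y => G y (j x • m))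
        (by constructor <;> intros <;> simp [add_smul])).mk'
      map_add' := fun m m' => Coind.ext fun h => by
        change sw k (fun x y => G y (j x • (m + m'))) h =
          sw k (fun x y => G y (j x • m)) h + sw k (fun x y => G y (j x • m')) h
        simp [sw, Finset.sum_add_distrib]
      map_smul' := fun b m => LinearMap.ext fun h => by
        change sw k (fun x y => G y (j x • (b : R) • m)) h =
          sw k (fun x y => adjSub hB x b • sw k (fun p q => G q (j p • m)) y) h
        have key := sw_assoc (k := k) (T := fun x y z => G z ((adj j x b * j y) • m))
          (by constructor <;> intros <;> simp [add_smul, add_mul, mul_add]) h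
        simp only [← map_sw, ← sw_smul_vec, sw_adj_mul] at key
        simp only [mul_smul] at key
        refine key.trans (sw_congr _ fun x y => ?_)
        rw [smul_sw]
        refine sw_congr _ fun p q => ?_
        rw [← map_smul]
        rfl }
  map_add' G G' := LinearMap.ext fun m => LinearMap.ext fun h => by
    change sw k (fun x y => (G + G') y (j x • m)) h =
      sw k (fun x y => G y (j x • m)) h + sw k (fun x y => G' y (j x • m)) h
    simp [sw, Finset.sum_add_distrib]
  map_smul' c G := LinearMap.ext fun m => LinearMap.ext fun h => by
    change sw k (fun x y => (c • G) y (j x • m)) h = c • sw k (fun x y => G y (j x • m)) h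
    simp [sw, Finset.smul_sum]

/-- G is recovered from its image by ∑ G(h₃)(h₂S⁻¹(h₁)m) = G(h)(m). -/
theorem Coind.ofHom_injective {Sinv : H →ₗ[k] H}
    (hinj : Function.Injective (antipode k : H →ₗ[k] H)) (hS : ∀ h, antipode k (Sinv h) = h) :
    Function.Injective (Coind.ofHom hB (V := V) (M := M)) := by
  rw [injective_iff_map_eq_zero]
  intro G hG
  have h0 : ∀ m h, sw k (fun x y => G y (j x • m)) h = 0 := fun m h =>
    LinearMap.congr_fun (LinearMap.congr_fun hG m) h
  ext h m
  have key := sw_assoc (k := k) (T := fun x y z => G z (j (y * Sinv x) • m))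
    (by constructor <;> intros <;> simp [add_smul, mul_add, add_mul]) h
  simp only [map_mul, mul_smul, h0, sw_zero] at key
  simp only [← mul_smul, ← map_mul] at key
  have h1 : ∀ x y : H, sw k (fun p q => G y (j (q * Sinv p) • m)) x =
      counit (R := k) x • G y m := fun x y => by
    rw [sw_mul_antipode_inv hinj hS (f := fun t => G y (j t • m))
      (by constructor <;> intros <;> simp [add_smul])]
    simp
  simp only [h1] at key
  rwa [sw_counit_left (f := fun t => G t m) (by constructor <;> intros <;> simp)] at key

theorem finrank_mul_finrank_hom_le [FiniteDimensional k H] [FiniteDimensional k M]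
    [FiniteDimensional k V] {Sinv : H →ₗ[k] H}
    (hinj : Function.Injective (antipode k : H →ₗ[k] H)) (hS : ∀ h, antipode k (Sinv h) = h) :
    finrank k H * finrank k (M →ₗ[B] V) ≤ finrank k (M →ₗ[B] Coind hB V) := by
  rw [← finrank_linearMap k k]
  exact LinearMap.finrank_le_finrank_of_injective (Coind.ofHom_injective hB hinj hS)

/-- Only simple modules that receive a nonzero map from M need zero core, because the maximizer is
one of them. Its coinduced module is faithful and tight, so all modules are tight: M is projective,
and every simple module has the same positive ratio. -/
theorem projective_of_coreFree [FiniteDimensional k H] [FiniteDimensional k B]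
    [FiniteDimensional k M] [Nontrivial M] {Sinv : H →ₗ[k] H}
    (hinj : Function.Injective (antipode k : H →ₗ[k] H)) (hS : ∀ h, antipode k (Sinv h) = h)
    (hM : ∀ I : Ideal B, IsCoatom I → (∃ f : M →ₗ[B] B ⧸ I, f ≠ 0) →
      ∀ b : B, (∀ (h : H) (v : B ⧸ I), adjSub hB h b • v = 0) → b = 0) :
    Module.Projective B M ∧ ∀ J : Ideal B, IsCoatom J → ∃ f : M →ₗ[B] B ⧸ J, f ≠ 0 := by
  have : Nontrivial B := Module.nontrivial B M
  obtain ⟨I, hI, hmax⟩ := exists_max_hom_ratio (k := k) (B := B) (M := M)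
  have hpos : ∀ J : Ideal B, IsCoatom J → 0 < finrank k (B ⧸ J) := fun J hJ => by
    have : Nontrivial (B ⧸ J) := Submodule.Quotient.nontrivial_iff.2 hJ.1
    exact finrank_pos
  have hd := hpos I hI
  -- A zero maximal ratio would give Hom(M, M) = 0.
  have hn : 0 < finrank k (M →ₗ[B] B ⧸ I) := by
    by_contra hn
    have h1 := mul_finrank_hom_le hmax (N := M)
    rw [Nat.eq_zero_of_not_pos hn, zero_mul] at h1
    have : Nontrivial (M →ₗ[B] M) := inferInstance
    have h2 : 0 < finrank k (M →ₗ[B] M) := finrank_pos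
    have := Nat.mul_pos hd h2
    omega
  have hne : ∀ J : Ideal B, 0 < finrank k (M →ₗ[B] B ⧸ J) → ∃ f : M →ₗ[B] B ⧸ J, f ≠ 0 :=
    fun J hJ => by
      have := nontrivial_of_finrank_pos hJ
      exact exists_ne 0
  have hfaith := Coind.faithful hB (hM I hI (hne I hn))
  have htight : finrank k (B ⧸ I) * finrank k (M →ₗ[B] Coind hB (B ⧸ I)) =
      finrank k (M →ₗ[B] B ⧸ I) * finrank k (Coind hB (B ⧸ I)) := by
    refine (mul_finrank_hom_le hmax).antisymm ?_
    have h1 := finrank_mul_finrank_hom_le hB (M := M) (V := B ⧸ I) hinj hS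
    have h2 : finrank k (Coind hB (B ⧸ I)) = finrank k H * finrank k (B ⧸ I) :=
      finrank_linearMap k k H (B ⧸ I)
    rw [h2]
    calc _ = finrank k (B ⧸ I) * (finrank k H * finrank k (M →ₗ[B] B ⧸ I)) := by ring
      _ ≤ _ := by gcongr
  refine ⟨projective_of_tight hmax hd htight hfaith, fun J hJ => hne J ?_⟩
  have h1 := tight_of_faithful hmax htight hfaith (N := B ⧸ J)
  have h2 := Nat.mul_pos hn (hpos J hJ)
  rw [← h1] at h2
  exact Nat.pos_of_mul_pos_left h2

end Coinduced

/-! ### Semisimplicity over an algebra generated by B and H -/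

section Semisimple

open Module

set_option linter.unusedSectionVars false

variable {k H R : Type*} [Field k] [Ring H] [HopfAlgebra k H] [Ring R] [Algebra k R]
  {j : H →ₐ[k] R} {B : Subalgebra k R}
  (hgen : Algebra.adjoin k ((B : Set R) ∪ Set.range j) = ⊤)
  (hB : ∀ h : H, ∀ b ∈ B, adj j h b ∈ B)

section

variable {M N : Type*} [AddCommGroup M] [Module k M] [Module R M] [IsScalarTower k R M]
  [AddCommGroup N] [Module k N] [Module R N] [IsScalarTower k R N]

include hgen

theorem smul_mem_of_adjoin (U : Submodule k M) (hU : ∀ b ∈ B, ∀ m ∈ U, b • m ∈ U)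
    (hU' : ∀ h : H, ∀ m ∈ U, j h • m ∈ U) (r : R) : ∀ m ∈ U, r • m ∈ U := by
  have hr : r ∈ Algebra.adjoin k ((B : Set R) ∪ Set.range j) := hgen ▸ Algebra.mem_top
  induction hr using Algebra.adjoin_induction with
  | mem x hx =>
    rcases hx with hx | ⟨h, rfl⟩
    · exact hU x hx
    · exact hU' h
  | algebraMap c => intro m hm; rw [algebraMap_smul]; exact U.smul_mem c hm
  | add x y _ _ hx hy => intro m hm; rw [add_smul]; exact U.add_mem (hx m hm) (hy m hm)
  | mul x y _ _ hx hy => intro m hm; rw [mul_smul]; exact hx _ (hy m hm)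

theorem map_smul_of_adjoin (f : M →ₗ[k] N) (hf : ∀ b ∈ B, ∀ m, f (b • m) = b • f m)
    (hf' : ∀ (h : H) (m), f (j h • m) = j h • f m) (r : R) : ∀ m, f (r • m) = r • f m := by
  have hr : r ∈ Algebra.adjoin k ((B : Set R) ∪ Set.range j) := hgen ▸ Algebra.mem_top
  induction hr using Algebra.adjoin_induction with
  | mem x hx =>
    rcases hx with hx | ⟨h, rfl⟩
    · exact hf x hx
    · exact hf' h
  | algebraMap c => intro m; rw [algebraMap_smul, algebraMap_smul, map_smul]
  | add x y _ _ hx hy => intro m; rw [add_smul, add_smul, map_add, hx, hy]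
  | mul x y _ _ hx hy => intro m; rw [mul_smul, mul_smul, hx, hy]

end

theorem algHom_mul_smul {M : Type*} [AddCommGroup M] [Module k M] [Module R M]
    [IsScalarTower k R M] (h : H) (b : B) (m : M) :
    j h • b • m = sw k (fun x y => adjSub hB x b • j y • m) h := by
  have h1 := congrArg (· • m) (sw_adj_mul j h (b : R))
  simp only [sw_smul_vec, mul_smul] at h1
  exact h1.symm

section Kernel

variable {M V : Type*} [AddCommGroup M] [Module k M] [Module R M] [IsScalarTower k R M]
  [AddCommGroup V] [Module B V]

/-- The largest `R`-submodule contained in the kernel of a `B`-linear map. -/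
def equivariantKernel (f : M →ₗ[B] V) : Submodule R M where
  carrier := {m | ∀ h, f (j h • m) = 0}
  add_mem' := by intro a b ha hb h; rw [smul_add, map_add, ha, hb, add_zero]
  zero_mem' := by simp
  smul_mem' r := by
    have h0 : ∀ (c : k) (m : M), f (c • m) = algebraMap k B c • f m := fun c m => by
      rw [← map_smul, algebraMap_smul]
    let U : Submodule k M :=
      { carrier := {m | ∀ h, f (j h • m) = 0}
        add_mem' := by intro a b ha hb h; rw [smul_add, map_add, ha, hb, add_zero]
        zero_mem' := by simp
        smul_mem' := by intro c m hm h; rw [smul_algebra_smul_comm, h0, hm, smul_zero] }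
    refine fun {m} => smul_mem_of_adjoin hgen U ?_ ?_ r m
    · intro b hb m hm h
      have h1 := algHom_mul_smul hB h ⟨b, hb⟩ m
      rw [show b • m = (⟨b, hb⟩ : B) • m from rfl, h1, map_sw]
      refine (sw_congr _ fun x y => ?_).trans (sw_zero (k := k) h)
      rw [map_smul, hm, smul_zero]
    · intro g m hm h
      rw [← mul_smul, ← map_mul]
      exact hm _

include hgen hB in
-- f(j(h)cm) = ∑ (h₁·c) f(j(h₂)m) = 0, so cm lies in the equivariant kernel, an R-submodule that is
-- zero because M is simple and f ≠ 0.
theorem smul_eq_zero_of_core [IsSimpleModule R M] {f : M →ₗ[B] V} (hf : f ≠ 0) {c : B}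
    (hc : ∀ (h : H) (v : V), adjSub hB h c • v = 0) (m : M) : c • m = 0 := by
  have h1 : equivariantKernel hgen hB f = ⊥ := by
    refine (eq_bot_or_eq_top _).resolve_right fun h => hf ?_
    ext m
    have : m ∈ equivariantKernel hgen hB f := h ▸ Submodule.mem_top
    simpa using this 1
  rw [← Submodule.mem_bot R, ← h1]
  intro h
  rw [algHom_mul_smul hB, map_sw]
  refine (sw_congr _ fun x y => ?_).trans (sw_zero (k := k) h)
  rw [map_smul, hc]

end Kernel

section Maschke

variable {X Y : Type*} [AddCommGroup X] [Module k X] [Module R X] [IsScalarTower k R X]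
  [AddCommGroup Y] [Module k Y] [Module R Y] [IsScalarTower k R Y]

include hB in
theorem antipode_smul_adj (h : H) (b : B) (x : X) :
    sw k (fun p q => j (antipode k p) • adjSub hB q b • x) h = b • j (antipode k h) • x := by
  have h1 := congrArg (· • x) (sw_antipode_mul_adj j h (b : R))
  simp only [sw_smul_vec, mul_smul] at h1
  exact h1

include hB hgen in
/-- An `R`-linear surjection that splits over `B` splits over `R`. -/
theorem exists_section_of_integral {L : H} (hL : IsNormalizedIntegral (k := k) L)
    (p : X →ₗ[R] Y) (s : Y →ₗ[B] X) (hs : ∀ y, p (s y) = y) :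
    ∃ t : Y →ₗ[R] X, ∀ y, p (t y) = y := by
  have h0 : ∀ (c : k) (m : Y), s (c • m) = c • s m := fun c m => by
    rw [← algebraMap_smul B c m, map_smul, algebraMap_smul]
  -- The Maschke average ∑ S(L₁) s(L₂y). It commutes with B by the adjoint commutation rules and
  -- with H by the Casimir property; ε(L) = 1 makes it a section.
  let t : Y →ₗ[k] X :=
    { toFun := fun y => sw k (fun a b => j (antipode k a) • s (j b • y)) L
      map_add' := fun y y' => by simp [sw, Finset.sum_add_distrib]
      map_smul' := fun c y => by simp [sw, smul_algebra_smul_comm, h0, Finset.smul_sum] }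
  have ht : ∀ y, t y = sw k (fun a b => j (antipode k a) • s (j b • y)) L := fun _ => rfl
  refine ⟨{ t with map_smul' := map_smul_of_adjoin hgen t ?_ ?_ }, fun y => ?_⟩
  · intro b hb y
    rw [ht, ht]
    have key := sw_assoc (k := k)
      (T := fun x y' z => j (antipode k x) • adjSub hB y' ⟨b, hb⟩ • s (j z • y))
      (by constructor <;> intros <;> simp [add_smul, smul_algebra_smul_comm, h0]) L
    simp only [antipode_smul_adj] at key
    change _ = (⟨b, hb⟩ : B) • sw k (fun u v => j (antipode k u) • s (j v • y)) L
    rw [smul_sw, key]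
    refine sw_congr _ fun u v => ?_
    rw [← smul_sw]
    congr 1
    rw [show b • y = (⟨b, hb⟩ : B) • y from rfl, algHom_mul_smul hB, map_sw]
    simp
  · intro h y
    rw [ht, ht, smul_sw]
    have key := hL.sw_mul_antipode (F := fun a b => j a • s (j b • y))
      (by constructor <;> intros <;> simp [add_smul, smul_algebra_smul_comm, h0]) h
    simpa [mul_smul] using key.symm
  · change p (t y) = y
    rw [ht, map_sw]
    simp only [map_smul, hs, ← mul_smul, ← map_mul]
    rw [sw_antipode_left (f := fun t => j t • y)
      (by constructor <;> intros <;> simp [add_smul]), hL.counit_eq]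
    simp

end Maschke

variable {X : Type*} [AddCommGroup X] [Module k X] [Module R X] [IsScalarTower k R X]

theorem exists_isCompl_of_section {R X : Type*} [Ring R] [AddCommGroup X] [Module R X]
    (N : Submodule R X) (t : X ⧸ N →ₗ[R] X) (ht : ∀ y, N.mkQ (t y) = y) :
    ∃ N', IsCompl N N' := by
  refine ⟨LinearMap.range t, ?_, ?_⟩
  · rw [Submodule.disjoint_def]
    rintro _ hx ⟨y, rfl⟩
    have := ht y
    rw [Submodule.mkQ_apply, (Submodule.Quotient.mk_eq_zero N).2 hx] at this
    rw [← this, map_zero]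
  · rw [codisjoint_iff, eq_top_iff]
    intro x _
    rw [← sub_add_cancel x (t (N.mkQ x))]
    refine Submodule.add_mem_sup ?_ ⟨_, rfl⟩
    rw [← Submodule.Quotient.mk_eq_zero N, ← N.mkQ_apply, map_sub, ht, sub_self]

include hgen hB in
-- Hom counting is used twice: for a simple R-submodule M₀, to show that every simple B-module has
-- zero core, and then for any nonzero quotient X/N, to show that it is B-projective.
theorem isSemisimpleModule_of_coatom [IsSemisimpleRing H] [FiniteDimensional k B]
    [FiniteDimensional k X] (hfaith : ∀ b : B, (∀ x : X, b • x = 0) → b = 0)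
    (K : Submodule B X) (hK : IsCoatom K) (hK0 : ∀ x : X, (∀ h, j h • x ∈ K) → x = 0) :
    IsSemisimpleModule R X := by
  obtain ⟨L, hL⟩ := exists_isNormalizedIntegral k H
  have hfin : FiniteDimensional k H := hL.finite
  have hinj := hL.antipode_injective
  obtain ⟨Sinv, hS⟩ := exists_antipode_inv hinj
  have hXn : Nontrivial X := by
    by_contra h
    rw [not_nontrivial_iff_subsingleton] at h
    exact hK.1 (Subsingleton.elim _ _)
  have : IsArtinian R X := isArtinian_of_tower k inferInstance
  obtain ⟨M₀, hM₀⟩ := IsAtomic.exists_atom (Submodule R X)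
  have hsimple : IsSimpleModule R M₀ := isSimpleModule_iff_isAtom.2 hM₀
  -- If b kills M₀, so do its translates. As K + M₀ = X, they map X into K; hence j(H)bX ⊆ K and bX
  -- = 0.
  have hfaith₀ : ∀ b : B, (∀ m : M₀, b • m = 0) → b = 0 := by
    intro b hb
    have h1 : ∀ (h : H) (m : M₀), adjSub hB h b • m = 0 := by
      intro h m
      change adj j h (b : R) • m = 0
      rw [adj_apply, sw_smul_vec]
      refine (sw_congr _ fun x y => ?_).trans (sw_zero (k := k) h)
      rw [mul_smul, mul_smul]
      exact (congrArg (j x • ·) (hb _)).trans (smul_zero _)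
    let M₁ : Submodule B X :=
      { carrier := M₀
        add_mem' := M₀.add_mem
        zero_mem' := M₀.zero_mem
        smul_mem' := fun b x hx => M₀.smul_mem (b : R) hx }
    have h2 : K ⊔ M₁ = ⊤ := by
      refine hK.2 _ (left_lt_sup.2 fun hle => hM₀.1 ?_)
      rw [eq_bot_iff]
      intro m hm
      exact hK0 m fun h => hle (M₀.smul_mem (j h) hm)
    have h3 : ∀ (h : H) (x : X), adjSub hB h b • x ∈ K := by
      intro h x
      obtain ⟨y, hy, z, hz, rfl⟩ := Submodule.mem_sup.1 (h2 ▸ Submodule.mem_top : x ∈ K ⊔ M₁)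
      rw [smul_add]
      refine K.add_mem (K.smul_mem _ hy) ?_
      have h4 : adjSub hB h b • z = 0 := congrArg Subtype.val (h1 h ⟨z, hz⟩)
      rw [h4]
      exact K.zero_mem
    refine hfaith b fun x => hK0 _ fun h => ?_
    rw [algHom_mul_smul hB]
    exact sw_mem K h fun p q => h3 p _
  have : Nontrivial M₀ := hsimple.nontrivial
  have hfinM : FiniteDimensional k M₀ := inferInstance
  obtain ⟨-, hall⟩ := projective_of_coreFree hB (M := M₀) hinj hS fun I hI ⟨f, hf⟩ c hc =>
    hfaith₀ c (smul_eq_zero_of_core hgen hB hf hc)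
  have hcore : ∀ I : Ideal B, IsCoatom I →
      ∀ b : B, (∀ (h : H) (v : B ⧸ I), adjSub hB h b • v = 0) → b = 0 := fun I hI c hc => by
    obtain ⟨f, hf⟩ := hall I hI
    exact hfaith₀ c (smul_eq_zero_of_core hgen hB hf hc)
  refine { exists_isCompl := fun N => ?_ }
  rcases subsingleton_or_nontrivial (X ⧸ N) with hN | hN
  · rw [Submodule.Quotient.subsingleton_iff] at hN
    exact ⟨⊥, hN ▸ isCompl_top_bot⟩
  obtain ⟨hproj, -⟩ := projective_of_coreFree hB (M := X ⧸ N) hinj hS fun I hI _ => hcore I hI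
  let q : X →ₗ[B] X ⧸ N :=
    { toFun := N.mkQ
      map_add' := map_add _
      map_smul' := fun b x => map_smul N.mkQ (b : R) x }
  obtain ⟨s, hs⟩ := Module.projective_lifting_property q LinearMap.id N.mkQ_surjective
  obtain ⟨t, ht⟩ := exists_section_of_integral hgen hB hL N.mkQ s fun y => LinearMap.congr_fun hs y
  exact exists_isCompl_of_section N t ht

end Semisimple

/-! ### Units from the Jacobson radical -/

section JacobsonUnits

variable {S : Type*} [Ring S]

theorem exists_left_inverse_of_mem_jacobson {x : S} (hx : x ∈ Ring.jacobson S) :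
    ∃ z, z * (1 - x) = 1 := by
  rw [← Ideal.jacobson_bot, Ideal.mem_jacobson_iff] at hx
  obtain ⟨z, hz⟩ := hx (-1)
  refine ⟨z, ?_⟩
  rw [Submodule.mem_bot, sub_eq_zero] at hz
  calc z * (1 - x) = z * -1 * x + z := by noncomm_ring
    _ = 1 := hz

/-- The left inverse z = 1 + zx of 1 - x again has a left inverse, which must be 1 - x. -/
theorem isUnit_one_sub_of_mem_jacobson {x : S} (hx : x ∈ Ring.jacobson S) : IsUnit (1 - x) := by
  obtain ⟨z, hz⟩ := exists_left_inverse_of_mem_jacobson hx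
  have h1 : z = 1 - -(z * x) := by rw [sub_neg_eq_add, ← hz]; noncomm_ring
  obtain ⟨w, hw⟩ := exists_left_inverse_of_mem_jacobson
    ((Ring.jacobson S).neg_mem ((Ring.jacobson S).mul_mem_left z hx))
  rw [← h1] at hw
  have h2 : w = 1 - x := by
    calc w = w * (z * (1 - x)) := by rw [hz, mul_one]
      _ = 1 - x := by rw [← mul_assoc, hw, one_mul]
  exact ⟨⟨1 - x, z, h2 ▸ hw, hz⟩, rfl⟩

end JacobsonUnits

/-! ### The semisimplicity criterion inside an ambient algebra -/

section Adjoin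

variable {k H E X : Type*} [Field k] [Ring H] [HopfAlgebra k H] [Ring E] [Algebra k E]
  [AddCommGroup X] [Module k X] [Module E X] [IsScalarTower k E X]

theorem isSemisimpleModule_adjoin [IsSemisimpleRing H] [FiniteDimensional k E]
    [FiniteDimensional k X] (hfaith : ∀ b : E, (∀ x : X, b • x = 0) → b = 0)
    (j₀ : H →ₐ[k] E) (B₀ : Subalgebra k E) (hB₀ : ∀ h : H, ∀ b ∈ B₀, adj j₀ h b ∈ B₀)
    (K₀ : Submodule B₀ X) (hK : IsCoatom K₀) (hK0 : ∀ x : X, (∀ h, j₀ h • x ∈ K₀) → x = 0) :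
    IsSemisimpleModule (Algebra.adjoin k ((B₀ : Set E) ∪ Set.range j₀)) X := by
  obtain ⟨R, hR⟩ : ∃ R, R = Algebra.adjoin k ((B₀ : Set E) ∪ Set.range j₀) := ⟨_, rfl⟩
  have hj : ∀ h, j₀ h ∈ R := fun h => hR ▸ Algebra.subset_adjoin (Or.inr ⟨h, rfl⟩)
  have hBR : ∀ b ∈ B₀, b ∈ R := fun b hb => hR ▸ Algebra.subset_adjoin (Or.inl hb)
  let j : H →ₐ[k] R := j₀.codRestrict R hj
  let B : Subalgebra k R := B₀.comap R.val
  have hadj : ∀ (h : H) (b : R), ((adj j h b : R) : E) = adj j₀ h b := by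
    intro h b
    rw [adj_apply, ← Subalgebra.coe_val, map_sw, adj_apply]
    rfl
  have hgen : Algebra.adjoin k ((B : Set R) ∪ Set.range j) = ⊤ := by
    have h1 : (B : Set R) ∪ Set.range j =
        ((↑) : R → E) ⁻¹' ((B₀ : Set E) ∪ Set.range j₀) := by
      ext x
      refine or_congr Iff.rfl ⟨?_, ?_⟩
      · rintro ⟨h, rfl⟩
        exact ⟨h, rfl⟩
      · rintro ⟨h, hh⟩
        exact ⟨h, Subtype.ext hh⟩
    rw [h1]
    subst hR
    exact Algebra.adjoin_adjoin_coe_preimage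
  have hB : ∀ h : H, ∀ b ∈ B, adj j h b ∈ B := fun h b hb => by
    change ((adj j h b : R) : E) ∈ B₀
    rw [hadj]
    exact hB₀ h _ hb
  rw [← hR]
  have hRf : FiniteDimensional k R := inferInstance
  have hBf : FiniteDimensional k B := FiniteDimensional.finiteDimensional_subalgebra B
  let K : Submodule B X :=
    { carrier := K₀
      add_mem' := K₀.add_mem
      zero_mem' := K₀.zero_mem
      smul_mem' := fun b f hf => K₀.smul_mem ⟨((b : R) : E), b.2⟩ hf }
  refine isSemisimpleModule_of_coatom hgen hB
    (fun b hb => Subtype.ext (Subtype.ext (hfaith _ hb))) K ⟨fun h => hK.1 ?_, fun N hN => ?_⟩ hK0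
  · rw [eq_top_iff]
    exact fun x _ => (h ▸ Submodule.mem_top : x ∈ K)
  · let N₀ : Submodule B₀ X :=
      { carrier := N
        add_mem' := N.add_mem
        zero_mem' := N.zero_mem
        smul_mem' := fun b f hf => N.smul_mem (⟨⟨b, hBR b b.2⟩, b.2⟩ : B) hf }
    have h1 : N₀ = ⊤ := hK.2 N₀ hN
    rw [eq_top_iff]
    exact fun x _ => (h1 ▸ Submodule.mem_top : x ∈ N₀)

end Adjoin

/-! ### Operators on functions from H to a simple module -/

namespace PartialHopfAction

section Regular

set_option linter.unusedSectionVars false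

variable {k H A : Type*} [Field k] [Ring H] [HopfAlgebra k H] [Ring A] [Algebra k A]
  (P : PartialHopfAction k H A) (V : Type*) [AddCommGroup V] [Module k V] [Module A V]
  [IsScalarTower k A V]

/-- Translation of functions `H → V`. -/
noncomputable def transl (k H V : Type*) [Field k] [Ring H] [Algebra k H] [AddCommGroup V]
    [Module k V] : H →ₐ[k] Module.End k (H →ₗ[k] V) :=
  AlgHom.ofLinearMap
    (LinearMap.mk₂ k (fun g f => f ∘ₗ LinearMap.mulRight k g)
      (fun _ _ _ => by ext; simp [mul_add]) (fun _ _ _ => by ext; simp)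
      (fun _ _ _ => by ext; simp) (fun _ _ _ => by ext; simp))
    (by ext; simp) (fun _ _ => by ext; simp [mul_assoc])

@[simp]
theorem transl_apply (g : H) (f : H →ₗ[k] V) (h : H) : transl k H V g f h = f (h * g) := rfl

theorem isBilin_act_smul (a : A) (f : H →ₗ[k] V) : IsBilin k (fun x y => P.act x a • f y) := by
  constructor <;> intros <;> simp [add_smul, smul_algebra_smul_comm]

/-- The operators `(φ(a) f) h = ∑ (h₁ · a) f(h₂)` on functions `H → V`. -/
noncomputable def mulOp : A →ₗ[k] Module.End k (H →ₗ[k] V) :=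
  LinearMap.mk₂ k (fun a f => (sw_isBilin_linear (P.isBilin_act_smul V a f)).mk')
    (fun _ _ _ => by ext; simp [sw, add_smul, Finset.sum_add_distrib])
    (fun _ _ _ => by ext; simp [sw, Finset.smul_sum])
    (fun _ _ _ => by ext; simp [sw, Finset.sum_add_distrib])
    (fun _ _ _ => by ext; simp [sw, Finset.smul_sum, smul_algebra_smul_comm])

theorem mulOp_apply (a : A) (f : H →ₗ[k] V) (h : H) :
    P.mulOp V a f h = sw k (fun x y => P.act x a • f y) h := rfl

theorem adj_mulOp_apply (h : H) (a : A) (f : H →ₗ[k] V) (t : H) :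
    adj (transl k H V) h (P.mulOp V a) f t = sw k (fun p q => P.act (p * h) a • f q) t := by
  rw [adj_apply, sw_apply, sw_apply]
  have h1 : ∀ x y : H, (transl k H V x * P.mulOp V a * transl k H V (antipode k y)) f t =
      sw k (fun p q => sw k (fun p' q' =>
        P.act (p * p') a • f (q * q' * antipode k y)) x) t := fun x y => by
    rw [← sw_comul_mul (F := fun p q => P.act p a • f (q * antipode k y))]
    · rfl
    · constructor <;> intros <;> simp [add_smul, add_mul, smul_algebra_smul_comm]
  simp only [h1]
  rw [sw_comm]
  refine sw_congr _ fun p q => ?_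
  rw [sw_assoc (T := fun u v y => P.act (p * u) a • f (q * v * antipode k y))
    (by constructor <;> intros <;> simp [add_smul, add_mul, mul_add, smul_algebra_smul_comm])]
  have h2 : ∀ x y : H, sw k (fun u v => P.act (p * x) a • f (q * u * antipode k v)) y =
      counit (R := k) y • P.act (p * x) a • f q := fun x y => by
    simp only [mul_assoc]
    rw [sw_antipode_right (f := fun t => P.act (p * x) a • f (q * t))
      (by constructor <;> intros <;> simp [mul_add, smul_algebra_smul_comm]), mul_one]
  simp only [h2]
  exact sw_counit_right (f := fun x => P.act (p * x) a • f q)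
    (by constructor <;> intros <;> simp [mul_add, add_smul]) h

theorem act_mul_act_sw (h g : H) (a b : A) :
    P.act h (a * P.act g b) = sw k (fun x y => P.act x a * P.act (y * g) b) h :=
  P.act_mul_act_repr h g a b _

/-- The link between the partial action and the genuine adjoint action: translates of φ(a) need not
lie in φ(A), but multiplying by φ(c) on the left brings them back. -/
theorem mulOp_mul_adj (c a : A) (h : H) :
    P.mulOp V c * adj (transl k H V) h (P.mulOp V a) = P.mulOp V (c * P.act h a) := by
  ext f t
  rw [Module.End.mul_apply, mulOp_apply, mulOp_apply]
  simp only [adj_mulOp_apply, act_mul_act_sw]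
  have key := sw_assoc (k := k) (T := fun x y z => (P.act x c * P.act (y * h) a) • f z)
    (by constructor <;> intros <;>
      simp [add_smul, add_mul, mul_add, smul_algebra_smul_comm]) t
  simp only [← sw_smul_vec] at key
  rw [key]
  refine sw_congr _ fun x y => ?_
  simp only [mul_smul, smul_sw]

theorem mulOp_apply_one (a : A) (f : H →ₗ[k] V) : P.mulOp V a f 1 = a • f 1 := by
  rw [mulOp_apply, sw_one (P.isBilin_act_smul V a f), P.one_act]

theorem adj_mulOp_apply_one (h : H) (a : A) (f : H →ₗ[k] V) :
    adj (transl k H V) h (P.mulOp V a) f 1 = P.act h a • f 1 := by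
  rw [adj_mulOp_apply, sw_one (by
    constructor <;> intros <;> simp [add_smul, add_mul, smul_algebra_smul_comm]), one_mul]

/-- The operators all of whose translates act on values at `1` and map the image of `A` to itself
under left multiplication. -/
noncomputable def envelope : Subalgebra k (Module.End k (H →ₗ[k] V)) where
  carrier := {b | ∀ h, (∀ f : H →ₗ[k] V, f 1 = 0 → adj (transl k H V) h b f 1 = 0) ∧
    ∀ a, P.mulOp V a * adj (transl k H V) h b ∈ LinearMap.range (P.mulOp V)}
  mul_mem' := by
    intro b b' hb hb' h
    rw [adj_mul]
    refine ⟨fun f hf => ?_, fun a => ?_⟩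
    · rw [sw_apply, sw_apply]
      refine (sw_congr _ fun x y => ?_).trans (sw_zero (k := k) h)
      exact (hb x).1 _ ((hb' y).1 f hf)
    · rw [mul_sw]
      refine sw_mem _ h fun x y => ?_
      obtain ⟨a', ha'⟩ := (hb x).2 a
      rw [← mul_assoc, ← ha']
      exact (hb' y).2 a'
  add_mem' := by
    intro b b' hb hb' h
    rw [map_add]
    refine ⟨fun f hf => ?_, fun a => ?_⟩
    · rw [LinearMap.add_apply, LinearMap.add_apply, (hb h).1 f hf, (hb' h).1 f hf, add_zero]
    · rw [mul_add]
      exact add_mem ((hb h).2 a) ((hb' h).2 a)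
  algebraMap_mem' := by
    intro c h
    rw [Algebra.algebraMap_eq_smul_one, map_smul, adj_one_right]
    refine ⟨fun f hf => ?_, fun a => ?_⟩
    · simp [hf]
    · simp only [mul_smul_comm, mul_one]
      exact Submodule.smul_mem _ _ (Submodule.smul_mem _ _ ⟨a, rfl⟩)

theorem adj_mem_envelope (h : H) (b : Module.End k (H →ₗ[k] V)) (hb : b ∈ P.envelope V) :
    adj (transl k H V) h b ∈ P.envelope V := by
  intro g
  rw [adj_adj]
  exact hb _

theorem mulOp_mem_envelope (a : A) : P.mulOp V a ∈ P.envelope V := by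
  refine fun h => ⟨fun f hf => ?_, fun c => ?_⟩
  · rw [adj_mulOp_apply_one, hf, smul_zero]
  · rw [mulOp_mul_adj]
    exact ⟨_, rfl⟩

/-- The operators generated by the envelope and the translations. -/
noncomputable def opAlgebra : Subalgebra k (Module.End k (H →ₗ[k] V)) :=
  Algebra.adjoin k ((P.envelope V : Set (Module.End k (H →ₗ[k] V))) ∪ Set.range (transl k H V))

/-- The criterion is applied to K = {f | f(1) = 0}. It is maximal because φ(a) acts on values at 1
as a acts on the simple module V; a function with all translates in K vanishes. -/
theorem isSemisimpleModule_opAlgebra [IsSemisimpleRing H] [FiniteDimensional k H]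
    [FiniteDimensional k V] [IsSimpleModule A V] :
    IsSemisimpleModule (P.opAlgebra V) (H →ₗ[k] V) := by
  let K : Submodule (P.envelope V) (H →ₗ[k] V) :=
    { carrier := {f | f 1 = 0}
      add_mem' := by
        intro f g hf hg
        change f 1 + g 1 = 0
        rw [show f 1 = 0 from hf, show g 1 = 0 from hg, add_zero]
      zero_mem' := rfl
      smul_mem' := by
        intro b f hf
        have h1 := (b.2 (1 : H)).1 f hf
        rwa [adj_one_left] at h1 }
  refine isSemisimpleModule_adjoin (fun b hb => LinearMap.ext hb) (transl k H V) (P.envelope V)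
    (P.adj_mem_envelope V) K ⟨fun htop => ?_, fun N hN => ?_⟩ fun f hf => ?_
  · have hV := IsSimpleModule.nontrivial A V
    obtain ⟨v, hv⟩ := exists_ne (0 : V)
    have h1 : ((counit (R := k) (A := H)).smulRight v : H →ₗ[k] V) ∈ K :=
      htop ▸ Submodule.mem_top
    have h2 : ((counit (R := k) (A := H)).smulRight v : H →ₗ[k] V) 1 = 0 := h1
    simp at h2
    exact hv h2
  · obtain ⟨f, hfN, hfK⟩ := SetLike.exists_of_lt hN
    rw [eq_top_iff]
    intro g _
    obtain ⟨a, ha⟩ := IsSimpleModule.toSpanSingleton_surjective A (m := f 1) hfK (g 1)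
    have ha' : a • f 1 = g 1 := ha
    let b : P.envelope V := ⟨P.mulOp V a, P.mulOp_mem_envelope V a⟩
    rw [← sub_add_cancel g (b • f)]
    refine N.add_mem (hN.le ?_) (N.smul_mem b hfN)
    change g 1 - P.mulOp V a f 1 = 0
    rw [mulOp_apply_one, ha', sub_self]
  · ext h
    have h1 : transl k H V h f 1 = 0 := hf h
    simpa using h1

end Regular

end PartialHopfAction

/-! ### The radical acts as zero; recovering coefficients -/

namespace PartialHopfAction

section Representation

set_option linter.unusedSectionVars false

variable {k H A : Type*} [Field k] [Ring H] [HopfAlgebra k H] [Ring A] [Algebra k A]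
  (P : PartialHopfAction k H A)

theorem smashTmul_mul (a b : A) (h g : H) :
    P.smashTmul a h * P.smashTmul b g =
      sw k (fun x y => P.smashTmul (a * P.act x b) (y * g)) h :=
  P.smashMul_tmul_repr a b h g _

theorem smash_induction {motive : P.Smash → Prop} (zero : motive 0)
    (tmul : ∀ a h, motive (P.smashTmul a h)) (add : ∀ x y, motive x → motive y → motive (x + y))
    (x : P.Smash) : motive x :=
  TensorProduct.induction_on x zero tmul add

/-- A linear map out of `A # H` given by a bilinear map. -/
noncomputable def smashLift {M : Type*} [AddCommGroup M] [Module k M] (f : A →ₗ[k] H →ₗ[k] M) :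
    P.Smash →ₗ[k] M :=
  (TensorProduct.lift f : A ⊗[k] H →ₗ[k] M)

@[simp]
theorem smashLift_tmul {M : Type*} [AddCommGroup M] [Module k M] (f : A →ₗ[k] H →ₗ[k] M)
    (a : A) (h : H) : P.smashLift f (P.smashTmul a h) = f a h :=
  TensorProduct.lift.tmul a h

theorem map_mul_of_tmul {E : Type*} [Ring E] [Algebra k E] (σ : P.Smash →ₗ[k] E)
    (hσ : ∀ a h b g, σ (P.smashTmul a h * P.smashTmul b g) =
      σ (P.smashTmul a h) * σ (P.smashTmul b g)) (x y : P.Smash) : σ (x * y) = σ x * σ y := by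
  induction x using P.smash_induction with
  | zero => simp
  | add x x' hx hx' => rw [add_mul, map_add, map_add, hx, hx', add_mul]
  | tmul a h =>
    induction y using P.smash_induction with
    | zero => simp
    | add y y' hy hy' => rw [mul_add, map_add, map_add, hy, hy', mul_add]
    | tmul b g => exact hσ a h b g

variable (V : Type*) [AddCommGroup V] [Module k V] [Module A V] [IsScalarTower k A V]

/-- The action of `A # H` on functions `H → V`. -/
noncomputable def opRep : P.Smash →ₗ[k] Module.End k (H →ₗ[k] V) :=
  P.smashLift ((LinearMap.mul k _).compl₁₂ (P.mulOp V) (transl k H V).toLinearMap)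

@[simp]
theorem opRep_tmul (a : A) (h : H) :
    P.opRep V (P.smashTmul a h) = P.mulOp V a * transl k H V h := by
  simp [opRep]

theorem opRep_mul (x y : P.Smash) : P.opRep V (x * y) = P.opRep V x * P.opRep V y := by
  refine P.map_mul_of_tmul _ (fun a h b g => ?_) x y
  rw [smashTmul_mul, map_sw, opRep_tmul, opRep_tmul, mul_assoc, ← mul_assoc (transl k H V h),
    ← sw_adj_mul, sw_mul, mul_sw]
  refine sw_congr _ fun p q => ?_
  rw [opRep_tmul, ← mulOp_mul_adj, map_mul]
  simp only [mul_assoc]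

theorem opRep_mem_opAlgebra (x : P.Smash) : P.opRep V x ∈ P.opAlgebra V := by
  induction x using P.smash_induction with
  | zero => rw [map_zero]; exact zero_mem _
  | add x y hx hy => rw [map_add]; exact add_mem hx hy
  | tmul a h =>
    rw [opRep_tmul]
    exact mul_mem (Algebra.subset_adjoin (Or.inl (P.mulOp_mem_envelope V a)))
      (Algebra.subset_adjoin (Or.inr ⟨h, rfl⟩))

/-- The image of A # H is a right ideal: τ(h)b = ∑ (h₁ ▷ b)τ(h₂), and φ(a)(h₁ ▷ b) lies in φ(A) by
the second clause of `envelope`. -/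
theorem opRep_mul_mem_range {ρ : Module.End k (H →ₗ[k] V)} (hρ : ρ ∈ P.opAlgebra V) :
    ∀ z, P.opRep V z * ρ ∈ LinearMap.range (P.opRep V) := by
  induction hρ using Algebra.adjoin_induction with
  | mem b hb =>
    intro z
    induction z using P.smash_induction with
    | zero => rw [map_zero, zero_mul]; exact zero_mem _
    | add x y hx hy => rw [map_add, add_mul]; exact add_mem hx hy
    | tmul a h =>
      rw [opRep_tmul]
      rcases hb with hb | ⟨g, rfl⟩
      · rw [mul_assoc, ← sw_adj_mul, mul_sw]
        refine sw_mem _ h fun x y => ?_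
        obtain ⟨a', ha'⟩ := (hb x).2 a
        exact ⟨P.smashTmul a' y, by rw [opRep_tmul, ha', mul_assoc]⟩
      · exact ⟨P.smashTmul a (h * g), by rw [opRep_tmul, map_mul, mul_assoc]⟩
  | algebraMap c =>
    intro z
    rw [Algebra.algebraMap_eq_smul_one, mul_smul_comm, mul_one]
    exact ⟨c • z, map_smul _ _ _⟩
  | add x y _ _ hx hy => intro z; rw [mul_add]; exact add_mem (hx z) (hy z)
  | mul x y _ _ hx hy =>
    intro z
    obtain ⟨z', hz'⟩ := hx z
    rw [← mul_assoc, ← hz']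
    exact hy z'

/-- The element `x (1 # 1)` of the partial smash product. -/
noncomputable def toPartialSmash (x : P.Smash) : P.PartialSmash := ⟨x * P.smashOne, x, rfl⟩

/-- The inclusion of the partial smash product in `A # H`. -/
noncomputable def partialSmashVal : P.PartialSmash →ₗ[k] P.Smash where
  toFun := Subtype.val
  map_add' _ _ := rfl
  map_smul' _ _ := rfl

theorem partialSmashVal_toPartialSmash (x : P.Smash) :
    P.partialSmashVal (P.toPartialSmash x) = x * P.smashOne := rfl

theorem partialSmashVal_injective : Function.Injective P.partialSmashVal :=
  Subtype.val_injective

theorem partialSmashVal_mul (x y : P.PartialSmash) :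
    P.partialSmashVal (x * y) = P.partialSmashVal x * P.partialSmashVal y := rfl

theorem partialSmashVal_one : P.partialSmashVal 1 = P.smashOne := rfl

theorem partialSmashVal_mul_one (x : P.PartialSmash) :
    P.partialSmashVal x * P.smashOne = P.partialSmashVal x := by
  rw [← partialSmashVal_one, ← partialSmashVal_mul, mul_one]

/-- In a simple R-submodule, if xm ≠ 0 then ρxm = m for some ρ in R. Replacing σ(1)ρ by some σ(z)
keeps the argument inside A # H: the left invertible 1 - zx kills m, so σ(1)m = 0. Since x = x·1,
this gives xm = 0. -/
theorem rep_smul_eq_zero_of_mem_jacobson {E X : Type*} [Ring E] [Algebra k E]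
    [AddCommGroup X] [Module E X] (σ : P.Smash →ₗ[k] E) (hσ : ∀ x y, σ (x * y) = σ x * σ y)
    (R : Subalgebra k E) (hmem : ∀ x, σ x ∈ R)
    (hR : ∀ ρ ∈ R, ∃ z, σ z = σ P.smashOne * ρ) [IsSemisimpleModule R X] {x : P.PartialSmash}
    (hx : x ∈ Ring.jacobson P.PartialSmash) (f : X) : σ (P.partialSmashVal x) • f = 0 := by
  have hkill : ∀ N : Submodule R X, IsSimpleModule R N →
      ∀ m ∈ N, σ (P.partialSmashVal x) • m = 0 := by
    intro N hN m hm
    by_contra hne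
    obtain ⟨y, hy⟩ : ∃ y, y = σ (P.partialSmashVal x) • m := ⟨_, rfl⟩
    rw [← hy] at hne
    have hyN : y ∈ N := hy ▸ N.smul_mem (⟨_, hmem (P.partialSmashVal x)⟩ : R) hm
    obtain ⟨ρ, hρ⟩ := IsSimpleModule.toSpanSingleton_surjective R
      (m := (⟨y, hyN⟩ : N)) (fun h => hne (congrArg Subtype.val h)) ⟨m, hm⟩
    have hρ' : (ρ : E) • y = m := congrArg Subtype.val hρ
    obtain ⟨z, hz⟩ := hR ρ ρ.2
    have h1 : σ (P.partialSmashVal (P.toPartialSmash z * x)) • m = σ P.smashOne • m := by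
      rw [partialSmashVal_mul, partialSmashVal_toPartialSmash, mul_assoc, smashOne_mul,
        hσ, mul_smul, hz, mul_smul, ← hy, hρ']
    have hjx := (Ring.jacobson P.PartialSmash).mul_mem_left (P.toPartialSmash z) hx
    obtain ⟨t, ht⟩ := exists_left_inverse_of_mem_jacobson hjx
    have h2 : σ (P.partialSmashVal (1 - P.toPartialSmash z * x)) • m = 0 := by
      rw [map_sub, map_sub, sub_smul, h1, partialSmashVal_one, sub_self]
    have h3 : σ P.smashOne • m = 0 := by
      rw [← partialSmashVal_one, ← ht, partialSmashVal_mul, hσ, mul_smul, h2, smul_zero]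
    apply hne
    rw [hy, ← partialSmashVal_mul_one, hσ, mul_smul, h3, smul_zero]
  have hf : f ∈ sSup { N : Submodule R X | IsSimpleModule R N } := by
    rw [IsSemisimpleModule.sSup_simples_eq_top]
    exact Submodule.mem_top
  rw [sSup_eq_iSup'] at hf
  refine Submodule.iSup_induction _ (motive := fun f => σ (P.partialSmashVal x) • f = 0) hf
    (fun N m hm => hkill N.1 N.2 m hm) (smul_zero _) fun f g hf hg => ?_
  rw [smul_add, hf, hg, add_zero]

theorem opRep_eq_zero_of_mem_jacobson [IsSemisimpleRing H] [FiniteDimensional k H]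
    [FiniteDimensional k V] [IsSimpleModule A V] {x : P.PartialSmash}
    (hx : x ∈ Ring.jacobson P.PartialSmash) : P.opRep V (P.partialSmashVal x) = 0 := by
  have := P.isSemisimpleModule_opAlgebra V
  exact LinearMap.ext fun f => P.rep_smul_eq_zero_of_mem_jacobson (P.opRep V) (P.opRep_mul V)
    (P.opAlgebra V) (P.opRep_mem_opAlgebra V)
    (fun ρ hρ => P.opRep_mul_mem_range V hρ P.smashOne) hx f

/-- The coefficient map `a # h ↦ p(h) a`. -/
noncomputable def coeff (p : H →ₗ[k] k) : P.Smash →ₗ[k] A :=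
  P.smashLift (LinearMap.mk₂ k (fun a h => p h • a)
    (by intros; simp) (by intros; exact smul_comm _ _ _) (by intros; simp [add_smul])
    (by intros; simp [mul_smul]))

@[simp]
theorem coeff_tmul (p : H →ₗ[k] k) (a : A) (h : H) :
    P.coeff p (P.smashTmul a h) = p h • a := by
  simp [coeff]

/-- Probing x with the functions t ↦ p(S⁻¹(h₂)t)v and evaluating at h₁ isolates the coefficient: for
x = a # g, the factor S⁻¹(h₃)h₂ cancels. -/
theorem act_coeff_smul {Sinv : H →ₗ[k] H} (hinj : Function.Injective (antipode k : H →ₗ[k] H))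
    (hS : ∀ h, antipode k (Sinv h) = h) (p : H →ₗ[k] k) (x : P.Smash) (h : H) (v : V) :
    P.act h (P.coeff p x) • v =
      sw k (fun u y => P.opRep V x ((p ∘ₗ LinearMap.mulLeft k (Sinv y)).smulRight v) u) h := by
  induction x using P.smash_induction with
  | zero => simp [sw_zero]
  | add x y hx hy =>
    rw [map_add, map_add, add_smul, hx, hy, sw, sw, sw, ← Finset.sum_add_distrib]
    refine Finset.sum_congr rfl fun i _ => ?_
    rw [map_add]
    rfl
  | tmul a g =>
    rw [coeff_tmul]
    obtain ⟨w, hw⟩ : ∃ w : H →ₗ[k] V, ∀ t, p t • v = w t := ⟨p.smulRight v, fun _ => rfl⟩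
    have h1 : ∀ u y : H,
        P.opRep V (P.smashTmul a g) ((p ∘ₗ LinearMap.mulLeft k (Sinv y)).smulRight v) u =
        sw k (fun s t => P.act s a • w (Sinv y * t * g)) u := fun u y => by
      rw [opRep_tmul, Module.End.mul_apply, mulOp_apply]
      simp [mul_assoc, hw]
    simp only [h1]
    rw [sw_assoc (T := fun s t y => P.act s a • w (Sinv y * t * g))
      (by constructor <;> intros <;>
        simp [add_smul, mul_add, add_mul, smul_algebra_smul_comm])]
    have h2 : ∀ x y : H, sw k (fun s t => P.act x a • w (Sinv t * s * g)) y =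
        counit (R := k) y • P.act x a • w g := fun x y => by
      rw [sw_antipode_inv_mul hinj hS (f := fun t => P.act x a • w (t * g))
        (by constructor <;> intros <;> simp [add_mul, smul_algebra_smul_comm]),
        one_mul]
    simp only [h2]
    rw [sw_counit_right (f := fun x => P.act x a • w g)
      (by constructor <;> intros <;> simp [add_smul]), ← hw, map_smul, smul_assoc,
      smul_algebra_smul_comm]

theorem act_coeff_smul_eq_zero [IsSemisimpleRing H]
    [FiniteDimensional k V] [IsSimpleModule A V] {x : P.PartialSmash}
    (hx : x ∈ Ring.jacobson P.PartialSmash) (p : H →ₗ[k] k) (h : H) (v : V) :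
    P.act h (P.coeff p (P.partialSmashVal x)) • v = 0 := by
  obtain ⟨L, hL⟩ := exists_isNormalizedIntegral k H
  have hfin : FiniteDimensional k H := hL.finite
  have hinj := hL.antipode_injective
  obtain ⟨Sinv, hS⟩ := exists_antipode_inv hinj
  rw [P.act_coeff_smul V hinj hS, P.opRep_eq_zero_of_mem_jacobson V hx]
  simp [sw_zero]

theorem sum_coeff_basis {ι : Type*} [Fintype ι] (b : Module.Basis ι k H) (x : P.Smash) :
    ∑ i, P.smashTmul (P.coeff (b.coord i) x) (b i) = x := by
  induction x using P.smash_induction with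
  | zero =>
    simp only [map_zero]
    exact Finset.sum_eq_zero fun i _ => TensorProduct.zero_tmul _ _
  | add x y hx hy =>
    conv_rhs => rw [← hx, ← hy, ← Finset.sum_add_distrib]
    refine Finset.sum_congr rfl fun i _ => ?_
    rw [map_add]
    exact TensorProduct.add_tmul _ _ _
  | tmul a h =>
    simp only [coeff_tmul]
    change ∑ i, (b.coord i h • a) ⊗ₜ[k] b i = a ⊗ₜ[k] h
    simp only [TensorProduct.smul_tmul, ← TensorProduct.tmul_sum]
    congr 1
    exact b.sum_repr h

end Representation

end PartialHopfAction

/-! ### Cofinite maximal left ideals and the Jacobson radical -/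

section Cofinite

theorem mem_jacobson_of_op {S : Type*} [Ring S] {x : S}
    (hx : MulOpposite.op x ∈ Ring.jacobson Sᵐᵒᵖ) : x ∈ Ring.jacobson S := by
  rw [← Ideal.jacobson_bot, Ideal.mem_jacobson_iff]
  intro y
  have h1 : MulOpposite.op (-(y * x)) ∈ Ring.jacobson Sᵐᵒᵖ := by
    rw [MulOpposite.op_neg, MulOpposite.op_mul]
    exact neg_mem (Ideal.mul_mem_right _ _ hx)
  obtain ⟨u, hu⟩ := isUnit_one_sub_of_mem_jacobson h1
  have h2 := congrArg MulOpposite.unop u.mul_inv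
  rw [hu] at h2
  refine ⟨MulOpposite.unop (↑u⁻¹ : Sᵐᵒᵖ), ?_⟩
  rw [Submodule.mem_bot, sub_eq_zero]
  simp only [MulOpposite.unop_mul, MulOpposite.unop_sub, MulOpposite.unop_one,
    MulOpposite.unop_op] at h2
  rw [← h2]
  noncomm_ring

variable {k : Type*} {A : Type*} [Field k] [Ring A] [Algebra k A]

/-- An element of all cofinite maximal left ideals acts as zero on finite-dimensional simple
right modules. -/
theorem smul_eq_zero_of_mem_cofinite {y : A}
    (hy : ∀ L : Ideal A, L.IsMaximal → FiniteDimensional k (A ⧸ L) → y ∈ L)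
    {V : Type*} [AddCommGroup V] [Module k V] [Module Aᵐᵒᵖ V] [IsScalarTower k Aᵐᵒᵖ V]
    [IsSimpleModule Aᵐᵒᵖ V] [FiniteDimensional k V] (v : V) : MulOpposite.op y • v = 0 := by
  let ρ : A →ₐ[k] (Module.End k V)ᵐᵒᵖ :=
    AlgHom.ofLinearMap
      ((MulOpposite.opLinearEquiv k).toLinearMap ∘ₗ (Algebra.lsmul k k V).toLinearMap ∘ₗ
        (MulOpposite.opLinearEquiv k (M := A)).toLinearMap)
      (MulOpposite.unop_injective (LinearMap.ext fun v => by simp))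
      (fun a b => MulOpposite.unop_injective (LinearMap.ext fun v => by simp))
  have hρ : ∀ a v, (ρ a).unop v = MulOpposite.op a • v := fun _ _ => rfl
  -- Maximal left ideals of the finite-dimensional image of A pull back to cofinite maximal left
  -- ideals of A. Units 1 - ya then carry the information to the right-hand side.
  have hyJ : ρ.rangeRestrict y ∈ Ring.jacobson ρ.range := by
    rw [Ring.jacobson_eq_sInf_isMaximal, Submodule.mem_sInf]
    intro m hm
    have hsurj : Function.Surjective ρ.rangeRestrict := ρ.rangeRestrict_surjective
    have hmax : (Ideal.comap ρ.rangeRestrict m).IsMaximal :=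
      Ideal.comap_isMaximal_of_surjective _ hsurj (H := hm)
    refine hy _ hmax ?_
    let g : A →ₗ[k] (ρ.range ⧸ m.restrictScalars k) :=
      (m.restrictScalars k).mkQ ∘ₗ ρ.rangeRestrict.toLinearMap
    have hg : LinearMap.ker g = (Ideal.comap ρ.rangeRestrict m).restrictScalars k := by
      ext a
      simp [g]
    have h1 : FiniteDimensional k (A ⧸ LinearMap.ker g) :=
      Module.Finite.equiv g.quotKerEquivRange.symm
    rw [hg] at h1
    exact Module.Finite.equiv (Submodule.Quotient.restrictScalarsEquiv k _)
  by_contra hne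
  obtain ⟨a, ha⟩ := IsSimpleModule.toSpanSingleton_surjective Aᵐᵒᵖ hne v
  have ha' : a • MulOpposite.op y • v = v := ha
  obtain ⟨u, hu⟩ := isUnit_one_sub_of_mem_jacobson
    (Ideal.mul_mem_right (ρ.rangeRestrict a.unop) _ hyJ)
  have h2 := congrArg (fun z : ρ.range => (z : (Module.End k V)ᵐᵒᵖ).unop v) u.mul_inv
  rw [hu] at h2
  have h3 : ((1 - ρ.rangeRestrict y * ρ.rangeRestrict a.unop : ρ.range) :
      (Module.End k V)ᵐᵒᵖ).unop v = 0 := by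
    change v - (ρ a.unop).unop ((ρ y).unop v) = 0
    rw [hρ, hρ, MulOpposite.op_unop, ha', sub_self]
  have h4 : v = 0 := by
    refine h2.symm.trans ?_
    change ((↑u⁻¹ : ρ.range) : (Module.End k V)ᵐᵒᵖ).unop (((1 - ρ.rangeRestrict y *
      ρ.rangeRestrict a.unop : ρ.range) : (Module.End k V)ᵐᵒᵖ).unop v) = 0
    rw [h3, map_zero]
  exact hne (by rw [h4, smul_zero])

/-- If simple left modules are finite-dimensional, all maximal left ideals are cofinite. For right
modules, y annihilates every simple one, and the radical is left-right symmetric. -/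
theorem mem_jacobson_of_mem_cofinite {k : Type w} {A : Type u} [Field k] [Ring A] [Algebra k A]
    (hfin :
      (∀ (V : Type u) [AddCommGroup V] [Module k V] [Module Aᵐᵒᵖ V] [IsScalarTower k Aᵐᵒᵖ V],
        IsSimpleModule Aᵐᵒᵖ V → FiniteDimensional k V) ∨
      (∀ (V : Type u) [AddCommGroup V] [Module k V] [Module A V] [IsScalarTower k A V],
        IsSimpleModule A V → FiniteDimensional k V)) {y : A}
    (hy : ∀ L : Ideal A, L.IsMaximal → FiniteDimensional k (A ⧸ L) → y ∈ L) :
    y ∈ Ring.jacobson A := by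
  rcases hfin with hfin | hfin
  · apply mem_jacobson_of_op
    rw [Ring.jacobson_eq_sInf_isMaximal, Submodule.mem_sInf]
    intro L (hL : Ideal.IsMaximal L)
    have hs : IsSimpleModule Aᵐᵒᵖ (Aᵐᵒᵖ ⧸ L) := isSimpleModule_iff_isCoatom.2 hL.out
    have hf : FiniteDimensional k (Aᵐᵒᵖ ⧸ L) := hfin _ hs
    have h1 := smul_eq_zero_of_mem_cofinite hy (Submodule.Quotient.mk (p := L) 1)
    rw [← Submodule.Quotient.mk_smul, Submodule.Quotient.mk_eq_zero] at h1
    simpa using h1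
  · rw [Ring.jacobson_eq_sInf_isMaximal, Submodule.mem_sInf]
    intro L (hL : Ideal.IsMaximal L)
    exact hy L hL (hfin _ (isSimpleModule_iff_isCoatom.2 hL.out))

end Cofinite

/-! ### Nakayama: from the radical of A to that of the partial smash product -/

namespace PartialHopfAction

section Nakayama

variable {k H A : Type*} [Field k] [Ring H] [HopfAlgebra k H] [Ring A] [Algebra k A]
  (P : PartialHopfAction k H A)

theorem smashTmul_one_mul (a b : A) (g : H) :
    P.smashTmul a 1 * P.smashTmul b g = P.smashTmul (a * b) g := by
  rw [smashTmul_mul, sw_one]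
  · rw [P.one_act, one_mul]
  · constructor <;> intros <;>
      simp [smashTmul, mul_add, add_mul, TensorProduct.add_tmul, TensorProduct.tmul_add,
        TensorProduct.smul_tmul'] <;> rfl

theorem smashTmul_one_mul_smashOne (a : A) :
    P.smashTmul a 1 * P.smashOne = P.smashTmul a 1 := by
  rw [smashOne, smashTmul_one_mul, mul_one]

/-- The embedding `a ↦ a # 1` of `A` in the partial smash product. -/
noncomputable def incl : A →+* P.PartialSmash where
  toFun a := P.toPartialSmash (P.smashTmul a 1)
  map_one' := P.partialSmashVal_injective (P.smashTmul_one_mul_smashOne 1)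
  map_mul' a b := P.partialSmashVal_injective <| by
    rw [partialSmashVal_mul]
    simp only [partialSmashVal_toPartialSmash, smashTmul_one_mul_smashOne, smashTmul_one_mul]
  map_zero' := P.partialSmashVal_injective <| by
    rw [partialSmashVal_toPartialSmash, smashTmul_one_mul_smashOne, map_zero]
    exact TensorProduct.zero_tmul _ _
  map_add' a b := P.partialSmashVal_injective <| by
    rw [map_add]
    simp only [partialSmashVal_toPartialSmash, smashTmul_one_mul_smashOne]
    exact TensorProduct.add_tmul _ _ _

theorem partialSmashVal_incl (a : A) : P.partialSmashVal (P.incl a) = P.smashTmul a 1 :=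
  P.smashTmul_one_mul_smashOne a

theorem sum_incl_mul {ι : Type*} [Fintype ι] (b : Module.Basis ι k H) (x : P.PartialSmash) :
    ∑ i, P.incl (P.coeff (b.coord i) (P.partialSmashVal x)) *
      P.toPartialSmash (P.smashTmul 1 (b i)) = x := by
  apply P.partialSmashVal_injective
  conv_rhs => rw [← partialSmashVal_mul_one, ← P.sum_coeff_basis b (P.partialSmashVal x)]
  rw [map_sum, Finset.sum_mul]
  refine Finset.sum_congr rfl fun i _ => ?_
  rw [partialSmashVal_mul, partialSmashVal_incl, partialSmashVal_toPartialSmash, ← mul_assoc,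
    smashTmul_one_mul, mul_one]

/-- The elements of `A` all of whose translates lie in the Jacobson radical. -/
def core : Submodule k A where
  carrier := {a | ∀ h, P.act h a ∈ Ring.jacobson A}
  add_mem' := by intro a b ha hb h; rw [map_add]; exact add_mem (ha h) (hb h)
  zero_mem' := by intro h; rw [map_zero]; exact zero_mem _
  smul_mem' := by
    intro c a ha h
    rw [map_smul, Algebra.smul_def]
    exact Ideal.mul_mem_left _ _ (ha h)

/-- The partial action axiom writes h·(a(g·c)) as a sum of left multiples of translates of c. This
makes `coreIdeal` a left ideal. -/
theorem mul_act_mem_core {c : A} (hc : c ∈ P.core) (a : A) (g : H) :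
    a * P.act g c ∈ P.core := by
  intro h
  rw [act_mul_act_sw]
  exact sw_mem _ h fun x y => Ideal.mul_mem_left _ _ (hc _)

/-- The elements of the partial smash product with coefficients in the core. -/
noncomputable def coreIdeal [FiniteDimensional k H] : Ideal P.PartialSmash where
  carrier := {x | ∀ p, P.coeff p (P.partialSmashVal x) ∈ P.core}
  add_mem' := by intro a b ha hb p; rw [map_add, map_add]; exact add_mem (ha p) (hb p)
  zero_mem' := by intro p; rw [map_zero, map_zero]; exact zero_mem _
  smul_mem' := by
    intro z x hx p
    rw [smul_eq_mul, partialSmashVal_mul,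
      ← P.sum_coeff_basis (Module.finBasis k H) (P.partialSmashVal x), Finset.mul_sum, map_sum]
    refine sum_mem fun i _ => ?_
    have hi := hx ((Module.finBasis k H).coord i)
    revert hi
    generalize P.coeff ((Module.finBasis k H).coord i) (P.partialSmashVal x) = c
    intro hc
    generalize P.partialSmashVal z = z
    induction z using P.smash_induction with
    | zero => rw [zero_mul, map_zero]; exact zero_mem _
    | add x y hx hy => rw [add_mul, map_add]; exact add_mem hx hy
    | tmul a g =>
      rw [smashTmul_mul, map_sw]
      refine sw_mem _ g fun x y => ?_
      rw [coeff_tmul]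
      exact P.core.smul_mem _ (P.mul_act_mem_core hc a x)

/-- A simple quotient M is generated over A by the images of finitely many 1 # bᵢ. If the core ideal
were not inside L, then M = J(A)M, against Nakayama. -/
theorem coreIdeal_le_jacobson [FiniteDimensional k H] :
    P.coreIdeal ≤ Ring.jacobson P.PartialSmash := by
  rw [Ring.jacobson_eq_sInf_isMaximal]
  refine le_sInf fun L (hL : L.IsMaximal) => ?_
  by_contra hle
  let M := P.PartialSmash ⧸ L
  let _ : Module A M := Module.compHom M P.incl
  have hsmul : ∀ (a : A) (x : P.PartialSmash),
      a • (Submodule.Quotient.mk x : M) = Submodule.Quotient.mk (P.incl a * x) := fun _ _ => rfl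
  let b := Module.finBasis k H
  have hsum : ∀ x : P.PartialSmash, (Submodule.Quotient.mk x : M) =
      ∑ i, P.coeff (b.coord i) (P.partialSmashVal x) •
        (Submodule.Quotient.mk (P.toPartialSmash (P.smashTmul 1 (b i))) : M) := fun x => by
    conv_lhs => rw [← P.sum_incl_mul b x]
    rw [← Submodule.mkQ_apply, map_sum]
    rfl
  have hfg : (⊤ : Submodule A M).FG := by
    rw [← eq_top_iff.2 (_ : (⊤ : Submodule A M) ≤ Submodule.span A (Set.range fun i =>
      (Submodule.Quotient.mk (P.toPartialSmash (P.smashTmul 1 (b i))) : M)))]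
    · exact Submodule.fg_span (Set.finite_range _)
    · intro m _
      obtain ⟨x, rfl⟩ := Submodule.Quotient.mk_surjective L m
      rw [hsum]
      exact sum_mem fun i _ => Submodule.smul_mem _ _ (Submodule.subset_span ⟨i, rfl⟩)
  have hne : (⊤ : Submodule A M) ≠ ⊥ := by
    have : Nontrivial M := Submodule.Quotient.nontrivial_iff.2 hL.ne_top
    exact top_ne_bot
  refine (hfg.jacobson_smul_lt hne).ne (eq_top_iff.2 ?_)
  intro m _
  obtain ⟨x, rfl⟩ := Submodule.Quotient.mk_surjective L m
  have hsup : L ⊔ P.coreIdeal = ⊤ := hL.out.2 _ (left_lt_sup.2 hle)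
  obtain ⟨l, hl, t, ht, rfl⟩ := Submodule.mem_sup.1 (hsup ▸ Submodule.mem_top : x ∈ L ⊔ P.coreIdeal)
  rw [Submodule.Quotient.mk_add, (Submodule.Quotient.mk_eq_zero L).2 hl, zero_add, hsum]
  refine sum_mem fun i _ => Submodule.smul_mem_smul ?_ Submodule.mem_top
  have := ht (b.coord i) 1
  rwa [P.one_act] at this

theorem incl_mem_jacobson [FiniteDimensional k H] {a : A} (ha : a ∈ P.core) :
    P.incl a ∈ Ring.jacobson P.PartialSmash := by
  refine P.coreIdeal_le_jacobson fun p => ?_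
  rw [partialSmashVal_incl, coeff_tmul]
  exact P.core.smul_mem _ ha

end Nakayama

end PartialHopfAction

/-! ### Irreducible partial modules are killed by the radical -/

namespace PartialHopfAction

section Primitive

variable {k H A : Type*} [Field k] [Ring H] [HopfAlgebra k H] [Ring A] [Algebra k A]
  {P : PartialHopfAction k H A} {I : Ideal A} [I.IsTwoSided] {hI : P.IsStable I}
  {M : Type*} [AddCommGroup M] [Module k M]

/-- The representation of `A # H` on a left partial `(A / I, H)`-module. -/
noncomputable def LeftPartialModule.rep [Module (A ⧸ I) M] [IsScalarTower k (A ⧸ I) M]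
    (Q : (quotient hI).LeftPartialModule M) : P.Smash →ₗ[k] Module.End k M :=
  P.smashLift ((LinearMap.mul k (Module.End k M)).compl₁₂
    ((Algebra.lsmul k k M).toLinearMap ∘ₗ (Ideal.Quotient.mkₐ k I).toLinearMap) Q.act)

theorem LeftPartialModule.rep_tmul [Module (A ⧸ I) M] [IsScalarTower k (A ⧸ I) M]
    (Q : (quotient hI).LeftPartialModule M) (a : A) (h : H) (m : M) :
    Q.rep (P.smashTmul a h) m = Ideal.Quotient.mk I a • Q.act h m := by
  simp [rep]

theorem LeftPartialModule.rep_mul [Module (A ⧸ I) M] [IsScalarTower k (A ⧸ I) M]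
    (Q : (quotient hI).LeftPartialModule M) (x y : P.Smash) :
    Q.rep (x * y) = Q.rep x * Q.rep y := by
  refine P.map_mul_of_tmul _ (fun a h b g => LinearMap.ext fun m => ?_) x y
  rw [smashTmul_mul, Module.End.mul_apply, rep_tmul, rep_tmul,
    Q.act_smul_act_repr _ _ _ _ (Coalgebra.Repr.arbitrary k h), sw, map_sum,
    LinearMap.sum_apply, Finset.smul_sum]
  refine Finset.sum_congr rfl fun i _ => ?_
  rw [rep_tmul, map_mul, mul_smul, quotient_act_mk]

theorem LeftPartialModule.rep_one [Module (A ⧸ I) M] [IsScalarTower k (A ⧸ I) M]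
    (Q : (quotient hI).LeftPartialModule M) : Q.rep P.smashOne = 1 :=
  LinearMap.ext fun m => by
    rw [smashOne, rep_tmul, Q.one_act, map_one, one_smul, Module.End.one_apply]

/-- If am ≠ 0, the (A # H)-orbit of am is a nonzero partial submodule, so m = z(am) for some z; the
left invertible 1 - z(a # 1) kills m. -/
theorem LeftPartialModule.IsIrreducible.smul_eq_zero_of_incl_mem_jacobson [Module (A ⧸ I) M]
    [IsScalarTower k (A ⧸ I) M] {Q : (quotient hI).LeftPartialModule M} (hQ : Q.IsIrreducible)
    {a : A} (ha : P.incl a ∈ Ring.jacobson P.PartialSmash) (m : M) :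
    Ideal.Quotient.mk I a • m = 0 := by
  by_contra hne
  let N : Submodule (A ⧸ I) M :=
    { carrier := {n | ∃ z, Q.rep z (Ideal.Quotient.mk I a • m) = n}
      add_mem' := by
        rintro _ _ ⟨z, rfl⟩ ⟨z', rfl⟩
        exact ⟨z + z', by rw [map_add]; rfl⟩
      zero_mem' := ⟨0, by rw [map_zero]; rfl⟩
      smul_mem' := by
        rintro c _ ⟨z, rfl⟩
        obtain ⟨c, rfl⟩ := Ideal.Quotient.mk_surjective c
        exact ⟨P.smashTmul c 1 * z, by
          rw [Q.rep_mul, Module.End.mul_apply, Q.rep_tmul, Q.one_act]⟩ }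
  have hN : N = ⊤ := by
    refine (hQ.2 N ?_).resolve_left fun h0 => hne ?_
    · rintro _ ⟨z, rfl⟩ h
      exact ⟨P.smashTmul 1 h * z, by
        rw [Q.rep_mul, Module.End.mul_apply, Q.rep_tmul, map_one, one_smul]⟩
    · have hmem : Ideal.Quotient.mk I a • m ∈ N :=
        ⟨P.smashOne, by rw [Q.rep_one, Module.End.one_apply]⟩
      rwa [h0, Submodule.mem_bot] at hmem
  obtain ⟨z, hz⟩ : m ∈ N := hN ▸ Submodule.mem_top
  obtain ⟨t, ht⟩ := exists_left_inverse_of_mem_jacobson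
    ((Ring.jacobson P.PartialSmash).mul_mem_left (P.toPartialSmash z) ha)
  have h1 : Q.rep (P.partialSmashVal (1 - P.toPartialSmash z * P.incl a)) m = 0 := by
    rw [map_sub, map_sub, partialSmashVal_one, Q.rep_one, partialSmashVal_mul,
      partialSmashVal_toPartialSmash, partialSmashVal_incl, Q.rep_mul, Q.rep_mul, Q.rep_one,
      mul_one, LinearMap.sub_apply, Module.End.mul_apply, Q.rep_tmul, Q.one_act, hz,
      Module.End.one_apply, sub_self]
  have h2 : m = 0 := by
    rw [← Module.End.one_apply (R := k) m, ← Q.rep_one, ← partialSmashVal_one, ← ht,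
      partialSmashVal_mul, Q.rep_mul, Module.End.mul_apply, h1, map_zero]
  exact hne (by rw [h2, smul_zero])

/-- The antirepresentation of `A # H` on a right partial `(A / I, H)`-module. -/
noncomputable def RightPartialModule.rep [Module (A ⧸ I)ᵐᵒᵖ M] [IsScalarTower k (A ⧸ I)ᵐᵒᵖ M]
    (Q : (quotient hI).RightPartialModule M) : P.Smash →ₗ[k] (Module.End k M)ᵐᵒᵖ :=
  P.smashLift ((LinearMap.mul k (Module.End k M)ᵐᵒᵖ).compl₁₂
    ((MulOpposite.opLinearEquiv k).toLinearMap ∘ₗ (Algebra.lsmul k k M).toLinearMap ∘ₗ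
      (MulOpposite.opLinearEquiv k).toLinearMap ∘ₗ (Ideal.Quotient.mkₐ k I).toLinearMap)
    ((MulOpposite.opLinearEquiv k).toLinearMap ∘ₗ Q.act.flip))

theorem RightPartialModule.rep_tmul [Module (A ⧸ I)ᵐᵒᵖ M] [IsScalarTower k (A ⧸ I)ᵐᵒᵖ M]
    (Q : (quotient hI).RightPartialModule M) (a : A) (h : H) (m : M) :
    (Q.rep (P.smashTmul a h)).unop m = Q.act (MulOpposite.op (Ideal.Quotient.mk I a) • m) h := by
  simp [rep]

theorem RightPartialModule.rep_mul [Module (A ⧸ I)ᵐᵒᵖ M] [IsScalarTower k (A ⧸ I)ᵐᵒᵖ M]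
    (Q : (quotient hI).RightPartialModule M) (x y : P.Smash) :
    Q.rep (x * y) = Q.rep x * Q.rep y := by
  refine P.map_mul_of_tmul _
    (fun a h b g => MulOpposite.unop_injective (LinearMap.ext fun m => ?_)) x y
  rw [smashTmul_mul, MulOpposite.unop_mul, Module.End.mul_apply, rep_tmul, rep_tmul,
    Q.act_smul_act_repr _ _ _ _ (Coalgebra.Repr.arbitrary k h), sw, map_sum,
    Finset.unop_sum, LinearMap.sum_apply]
  refine Finset.sum_congr rfl fun i _ => ?_
  rw [rep_tmul, map_mul (Ideal.Quotient.mk I), MulOpposite.op_mul, mul_smul, quotient_act_mk]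

theorem RightPartialModule.rep_one [Module (A ⧸ I)ᵐᵒᵖ M] [IsScalarTower k (A ⧸ I)ᵐᵒᵖ M]
    (Q : (quotient hI).RightPartialModule M) : Q.rep P.smashOne = 1 :=
  MulOpposite.unop_injective <| LinearMap.ext fun m => by
    rw [smashOne, rep_tmul, Q.act_one, map_one, MulOpposite.op_one, one_smul,
      MulOpposite.unop_one, Module.End.one_apply]

theorem RightPartialModule.IsIrreducible.smul_eq_zero_of_incl_mem_jacobson
    [Module (A ⧸ I)ᵐᵒᵖ M] [IsScalarTower k (A ⧸ I)ᵐᵒᵖ M]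
    {Q : (quotient hI).RightPartialModule M} (hQ : Q.IsIrreducible)
    {a : A} (ha : P.incl a ∈ Ring.jacobson P.PartialSmash) (m : M) :
    MulOpposite.op (Ideal.Quotient.mk I a) • m = 0 := by
  by_contra hne
  let N : Submodule (A ⧸ I)ᵐᵒᵖ M :=
    { carrier := {n | ∃ z, (Q.rep z).unop (MulOpposite.op (Ideal.Quotient.mk I a) • m) = n}
      add_mem' := by
        rintro _ _ ⟨z, rfl⟩ ⟨z', rfl⟩
        exact ⟨z + z', by rw [map_add]; rfl⟩
      zero_mem' := ⟨0, by rw [map_zero]; rfl⟩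
      smul_mem' := by
        rintro c _ ⟨z, rfl⟩
        obtain ⟨c, rfl⟩ := MulOpposite.op_surjective c
        obtain ⟨c, rfl⟩ := Ideal.Quotient.mk_surjective c
        exact ⟨z * P.smashTmul c 1, by
          rw [Q.rep_mul, MulOpposite.unop_mul, Module.End.mul_apply, Q.rep_tmul, Q.act_one]⟩ }
  have hN : N = ⊤ := by
    refine (hQ.2 N ?_).resolve_left fun h0 => hne ?_
    · rintro _ ⟨z, rfl⟩ h
      exact ⟨z * P.smashTmul 1 h, by
        rw [Q.rep_mul, MulOpposite.unop_mul, Module.End.mul_apply, Q.rep_tmul, map_one,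
          MulOpposite.op_one, one_smul]⟩
    · have hmem : MulOpposite.op (Ideal.Quotient.mk I a) • m ∈ N :=
        ⟨P.smashOne, by rw [Q.rep_one, MulOpposite.unop_one, Module.End.one_apply]⟩
      rwa [h0, Submodule.mem_bot] at hmem
  obtain ⟨z, hz⟩ : m ∈ N := hN ▸ Submodule.mem_top
  -- On a right module the inverse must stand on the right, so a two-sided unit is needed.
  obtain ⟨t, ht⟩ := isUnit_one_sub_of_mem_jacobson
    (Ideal.mul_mem_right (P.toPartialSmash z) (Ring.jacobson P.PartialSmash) ha)
  have h1 : (Q.rep (P.partialSmashVal (1 - P.incl a * P.toPartialSmash z))).unop m = 0 := by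
    rw [map_sub, map_sub, partialSmashVal_one, Q.rep_one, partialSmashVal_mul,
      partialSmashVal_toPartialSmash, partialSmashVal_incl, Q.rep_mul, Q.rep_mul, Q.rep_one,
      mul_one, MulOpposite.unop_sub, MulOpposite.unop_mul, LinearMap.sub_apply,
      Module.End.mul_apply, Q.rep_tmul, Q.act_one, hz, MulOpposite.unop_one,
      Module.End.one_apply, sub_self]
  have h2 : m = 0 := by
    rw [← Module.End.one_apply (R := k) m, ← MulOpposite.unop_one, ← Q.rep_one,
      ← partialSmashVal_one, ← t.mul_inv, ht, partialSmashVal_mul, Q.rep_mul,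
      MulOpposite.unop_mul, Module.End.mul_apply, h1, map_zero]
  exact hne (by rw [h2, smul_zero])

end Primitive

/-! ### Assembling the proof -/

section Semiprimitive

variable {k : Type w} {H : Type v} {A : Type u} [Field k] [Ring H] [HopfAlgebra k H] [Ring A]
  [Algebra k A] (P : PartialHopfAction k H A)

theorem mem_leftJacobson_of_incl_mem_jacobson {a : A}
    (ha : P.incl a ∈ Ring.jacobson P.PartialSmash) : a ∈ P.leftJacobson := by
  rw [leftJacobson, Submodule.mem_sInf]
  rintro I ⟨_, hI, M, _, _, _, _, Q, hQ, hfaith⟩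
  rw [← Ideal.Quotient.eq_zero_iff_mem]
  exact hfaith _ (hQ.smul_eq_zero_of_incl_mem_jacobson ha)

theorem mem_rightJacobson_of_incl_mem_jacobson {a : A}
    (ha : P.incl a ∈ Ring.jacobson P.PartialSmash) : a ∈ P.rightJacobson := by
  rw [rightJacobson, Submodule.mem_sInf]
  rintro I ⟨_, hI, M, _, _, _, _, Q, hQ, hfaith⟩
  rw [← Ideal.Quotient.eq_zero_iff_mem]
  exact hfaith _ (hQ.smul_eq_zero_of_incl_mem_jacobson ha)

variable {P} in
theorem IsSemiprimitive.eq_zero_of_incl_mem_jacobson (hA : P.IsSemiprimitive) {a : A}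
    (ha : P.incl a ∈ Ring.jacobson P.PartialSmash) : a = 0 := by
  rcases hA with h | h
  · simpa [h] using P.mem_rightJacobson_of_incl_mem_jacobson ha
  · simpa [h] using P.mem_leftJacobson_of_incl_mem_jacobson ha

theorem coeff_mem_core [IsSemisimpleRing H]
    (hfin :
      (∀ (V : Type u) [AddCommGroup V] [Module k V] [Module Aᵐᵒᵖ V] [IsScalarTower k Aᵐᵒᵖ V],
        IsSimpleModule Aᵐᵒᵖ V → FiniteDimensional k V) ∨
      (∀ (V : Type u) [AddCommGroup V] [Module k V] [Module A V] [IsScalarTower k A V],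
        IsSimpleModule A V → FiniteDimensional k V))
    {x : P.PartialSmash} (hx : x ∈ Ring.jacobson P.PartialSmash) (p : H →ₗ[k] k) :
    P.coeff p (P.partialSmashVal x) ∈ P.core := by
  refine fun h => mem_jacobson_of_mem_cofinite hfin fun L hL _ => ?_
  have hs : IsSimpleModule A (A ⧸ L) := isSimpleModule_iff_isCoatom.2 hL.out
  -- Annihilating the class of 1 in A/L means lying in L.
  have h1 := P.act_coeff_smul_eq_zero (A ⧸ L) hx p h (Submodule.Quotient.mk 1)
  rwa [← Submodule.Quotient.mk_smul, Submodule.Quotient.mk_eq_zero, smul_eq_mul, mul_one] at h1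

end Semiprimitive

end PartialHopfAction

end

theorem mainTheorem2 {k : Type w} {H : Type v} {A : Type u}
    [Field k] [Ring H] [HopfAlgebra k H] [Ring A] [Algebra k A]
    (P : PartialHopfAction k H A)
    (hH : IsSemisimpleRing H)
    (hA : P.IsSemiprimitive)
    (hfin :
      (∀ (V : Type u) [AddCommGroup V] [Module k V] [Module Aᵐᵒᵖ V] [IsScalarTower k Aᵐᵒᵖ V],
        IsSimpleModule Aᵐᵒᵖ V → FiniteDimensional k V) ∨
      (∀ (V : Type u) [AddCommGroup V] [Module k V] [Module A V] [IsScalarTower k A V],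
        IsSimpleModule A V → FiniteDimensional k V)) :
    Ring.jacobson P.PartialSmash = ⊥ := by
  obtain ⟨L, hL⟩ := exists_isNormalizedIntegral k H
  have hHfin : FiniteDimensional k H := hL.finite
  refine eq_bot_iff.2 fun x hx => ?_
  -- Each coefficient lies in the core, so its image a # 1 is in the radical, and H-semiprimitivity
  -- kills it.
  have hcoeff : ∀ p, P.coeff p (P.partialSmashVal x) = 0 := fun p =>
    hA.eq_zero_of_incl_mem_jacobson (P.incl_mem_jacobson (P.coeff_mem_core hfin hx p))
  rw [Submodule.mem_bot]
  apply P.partialSmashVal_injective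
  rw [map_zero, ← P.sum_coeff_basis (Module.finBasis k H) (P.partialSmashVal x)]
  exact Finset.sum_eq_zero fun i _ => by rw [hcoeff]; exact TensorProduct.zero_tmul _ _
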